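/- Let $(M,g,I_1,I_2,I_3)$ be a hyperkähler manifold of real dimension $4$ (so $I_1I_2=I_3$), with Kähler forms $\omega_a=g(I_a\cdot,\cdot)$, $a=1,2,3$. For $\zeta=(\zeta_1,\zeta_2,\zeta_3)\in S^2$ put $I_\zeta=\zeta_1I_1+\zeta_2I_2+\zeta_3I_3$. For a nondegenerate $2$-form $\omega$ let $\omega^{-1}$ be the dual bivector, $\omega^{-1}(\omega(X,\cdot),\omega(Y,\cdot))=\omega(X,Y)$. Write $TM\otimes\mathbb C=E\otimes H$, where $H=\mathbb C^2$ is the standard representation of the unit quaternions (acting through $I_1,I_2,I_3$), so that $\Lambda^2(TM\otimes\mathbb C)=(\Lambda^2E\otimes S^2H)\oplus(S^2E\otimes\Lambda^2H)$. A smooth real bivector field $\Pi\in\Gamma(\Lambda^2TM)$ is called hyper-Poisson if (i) $\Pi\in\Gamma(\Lambda^2E\otimes S^2H)$, and (ii) for each $\zeta\in S^2$ the $(2,0)$-component $\Pi^{2,0}_\zeta$ of $\Pi$ with respect to $I_\zeta$ is a holomorphic Poisson bivector on $(M,I_\zeta)$, i.e. it is holomorphic and its Schouten bracket with itself vanishes.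 A hyper-Poisson bivector $\Pi$ is called compatible with the hyperkähler structure if for each $\zeta\in S^2$ every complex linear combination of $\Pi^{2,0}_\zeta$ and $\Omega_\zeta^{-1}$ is a holomorphic Poisson bivector on $(M,I_\zeta)$, where $\Omega_\zeta$ is the parallel $I_\zeta$-holomorphic symplectic form (unique up to a constant factor; $\Omega_\zeta=\sum_i b_i\omega_i+\sqrt{-1}\sum_i c_i\omega_i$ for $b,c\in\mathbb R^3$ orthonormal with $b\times c=\zeta$) and $\Omega_\zeta^{-1}$ is the dual bivector of type $(2,0)$. Then a smooth bivector field $\Pi$ on $M$ is hyper-Poisson if and only if $$\Pi=f_1\omega_1^{-1}+f_2\omega_2^{-1}+f_3\omega_3^{-1}$$ for smooth functions $f_1,f_2,f_3:M\to\mathbb R$ satisfying $I_1df_1=I_2df_2=I_3df_3$, where $(I_a\alpha)(X)=\alpha(I_aX)$. Every such bivector is compatible with the hyperkähler structure. -/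

import Mathlib

open Bundle
open scoped Manifold ContDiff TensorProduct Matrix

noncomputable section

namespace HyperPoisson

section Pointwise

/-! ### Linear algebra at one point

`V` is a real (tangent) space. Complex covectors are the real-linear maps `V → ℂ`, i.e. the elements
of `V* ⊗ ℂ`; complex bivectors are the complex bilinear forms on complex covectors (alternating
where it matters), i.e. the elements of `Λ² (V ⊗ ℂ)`. -/

variable {V : Type*} [AddCommGroup V] [Module ℝ V] [TopologicalSpace V]

/-- Complex covectors, `V* ⊗ ℂ`. -/
abbrev CCovector (V : Type*) [AddCommGroup V] [Module ℝ V] [TopologicalSpace V] : Type _ :=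
  V →L[ℝ] ℂ

/-- Complex bilinear forms on complex covectors; the alternating ones are the complex bivectors. -/
abbrev CBivector (V : Type*) [AddCommGroup V] [Module ℝ V] [TopologicalSpace V] : Type _ :=
  CCovector V →ₗ[ℂ] CCovector V →ₗ[ℂ] ℂ

/-- The real part of a complex covector. -/
def rePart (α : CCovector V) : V →L[ℝ] ℝ := Complex.reCLM.comp α

/-- The imaginary part of a complex covector. -/
def imPart (α : CCovector V) : V →L[ℝ] ℝ := Complex.imCLM.comp α

theorem rePart_add (α β : CCovector V) : rePart (α + β) = rePart α + rePart β := by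
  ext v; simp [rePart]

theorem imPart_add (α β : CCovector V) : imPart (α + β) = imPart α + imPart β := by
  ext v; simp [imPart]

theorem rePart_smul (c : ℂ) (α : CCovector V) :
    rePart (c • α) = c.re • rePart α - c.im • imPart α := by
  ext v; simp [rePart, imPart]

theorem imPart_smul (c : ℂ) (α : CCovector V) :
    imPart (c • α) = c.re • imPart α + c.im • rePart α := by
  ext v; simp [rePart, imPart]

/-- The complex bilinear extension of a real bivector to complex covectors. -/
def complexify (P : (V →L[ℝ] ℝ) →ₗ[ℝ] (V →L[ℝ] ℝ) →ₗ[ℝ] ℝ) : CBivector V :=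
  LinearMap.mk₂ ℂ
    (fun α β =>
      (⟨P (rePart α) (rePart β) - P (imPart α) (imPart β),
        P (rePart α) (imPart β) + P (imPart α) (rePart β)⟩ : ℂ))
    (fun α α' β => by
      apply Complex.ext <;> simp [rePart_add, imPart_add] <;> ring)
    (fun c α β => by
      apply Complex.ext <;> simp [rePart_smul, imPart_smul] <;> ring)
    (fun α β β' => by
      apply Complex.ext <;> simp [rePart_add, imPart_add] <;> ring)
    (fun c α β => by
      apply Complex.ext <;> simp [rePart_smul, imPart_smul] <;> ring)

/-- The `(1,0)`-part `(α - i α ∘ J) / 2` of a complex covector, with respect to a complex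
structure `J`. -/
def proj10 (J : V →L[ℝ] V) : CCovector V →ₗ[ℂ] CCovector V where
  toFun α := (2⁻¹ : ℂ) • (α - Complex.I • α.comp J)
  map_add' α β := by ext v; simp; ring
  map_smul' c α := by ext v; simp; ring

/-- The `(2,0)`-component of a complex bivector: the component in `Λ² T^{1,0}` of the decomposition
`Λ² T^ℂ = Λ² T^{1,0} ⊕ (T^{1,0} ⊗ T^{0,1}) ⊕ Λ² T^{0,1}`. -/
def component20 (J : V →L[ℝ] V) (σ : CBivector V) : CBivector V :=
  σ.compl₁₂ (proj10 J) (proj10 J)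

/-- `σ` is a complex bivector of type `(2,0)`, i.e. an element of `Λ² T^{1,0}`. -/
def IsType20 (J : V →L[ℝ] V) (σ : CBivector V) : Prop :=
  (∀ α, σ α α = 0) ∧ ∀ α β, σ (α.comp J) β = Complex.I * σ α β

/-- The pairing of a complex covector with a complexified tangent vector. -/
def pair (α : CCovector V) : ℂ ⊗[ℝ] V →ₗ[ℂ] ℂ :=
  LinearMap.liftBaseChange ℂ (α : V →ₗ[ℝ] ℂ)

theorem pair_add (α β : CCovector V) (Z : ℂ ⊗[ℝ] V) : pair (α + β) Z = pair α Z + pair β Z := by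
  induction Z using TensorProduct.induction_on with
  | zero => simp
  | tmul c v => simp [pair]
  | add x y hx hy => rw [map_add, map_add, map_add, hx, hy]; ring

theorem pair_smul (c : ℂ) (α : CCovector V) (Z : ℂ ⊗[ℝ] V) : pair (c • α) Z = c * pair α Z := by
  induction Z using TensorProduct.induction_on with
  | zero => simp
  | tmul d v => simp [pair]
  | add x y hx hy => rw [map_add, map_add, hx, hy]; ring

/-- The complex bivector `Z ∧ W`, as `(α, β) ↦ α(Z) β(W) - α(W) β(Z)`. -/
def wedge (Z W : ℂ ⊗[ℝ] V) : CBivector V :=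
  LinearMap.mk₂ ℂ (fun α β => pair α Z * pair β W - pair α W * pair β Z)
    (fun α α' β => by simp only [pair_add]; ring)
    (fun c α β => by simp only [pair_smul, smul_eq_mul]; ring)
    (fun α β β' => by simp only [pair_add]; ring)
    (fun c α β => by simp only [pair_smul, smul_eq_mul]; ring)

/-- The unit quaternions `i, j, k` acting on `H = ℂ²`, the standard representation of `Sp(1)`. -/
def quaternionAction : Fin 3 → Matrix (Fin 2) (Fin 2) ℂ :=
  ![!![Complex.I, 0; 0, -Complex.I], !![0, 1; -1, 0], !![0, Complex.I; Complex.I, 0]]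

/-- The space `E = Hom_ℍ(H, V ⊗ ℂ)` attached to a quaternionic structure `J` on `V`, so that
evaluation is the isomorphism `E ⊗ H ≃ V ⊗ ℂ`. -/
def IsInE (J : Fin 3 → V →L[ℝ] V) (φ : (Fin 2 → ℂ) →ₗ[ℂ] ℂ ⊗[ℝ] V) : Prop :=
  ∀ (a : Fin 3) (h : Fin 2 → ℂ),
    φ (quaternionAction a *ᵥ h) = LinearMap.baseChange ℂ (J a : V →ₗ[ℝ] V) (φ h)

/-- The summand `Λ² E ⊗ S² H` of `Λ² (E ⊗ H) = Λ² (V ⊗ ℂ)`. The inclusion sends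
`(φ ∧ ψ) ⊗ (h k)` to `(φ ⊗ h) ∧ (ψ ⊗ k) + (φ ⊗ k) ∧ (ψ ⊗ h)`. -/
def lambda2E_S2H (J : Fin 3 → V →L[ℝ] V) : Submodule ℂ (CBivector V) :=
  Submodule.span ℂ
    {σ | ∃ φ ψ : (Fin 2 → ℂ) →ₗ[ℂ] ℂ ⊗[ℝ] V, IsInE J φ ∧ IsInE J ψ ∧
      ∃ h k : Fin 2 → ℂ, σ = wedge (φ h) (ψ k) + wedge (φ k) (ψ h)}

/-- The bivector `η⁻¹` dual to a nondegenerate 2-form `η`: `η⁻¹(α, β) = η(X, Y)` where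
`η(X, ·) = α` and `η(Y, ·) = β`. -/
def inverseBivector [IsTopologicalAddGroup V] [ContinuousSMul ℝ V]
    (η : V →L[ℝ] V →L[ℝ] ℝ) (α β : V →L[ℝ] ℝ) : ℝ :=
  η (η.inverse α) (η.inverse β)

/-- `P = Ω⁻¹` for a nondegenerate complex 2-form `Ω` of type `(2,0)`: the bivector `P` of type
`(2,0)` with `P(Ω(X, ·), Ω(Y, ·)) = Ω(X, Y)`. The covectors `Ω(X, ·)` are precisely those of type
`(1,0)`, so there is exactly one such `P`. -/
def IsInverse20 (J : V →L[ℝ] V) (Ω : V → CCovector V) (P : CBivector V) : Prop :=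
  IsType20 J P ∧ ∀ X Y, P (Ω X) (Ω Y) = Ω X Y

end Pointwise

section Manifold

variable (n : ℕ) (M : Type*) [TopologicalSpace M] [ChartedSpace (EuclideanSpace ℝ (Fin n)) M]

/-- Fields of endomorphisms of the tangent bundle. -/
abbrev EndField : Type _ := ∀ x : M, TangentSpace (𝓡 n) x →L[ℝ] TangentSpace (𝓡 n) x

/-- Fields of real bilinear forms on the tangent bundle. -/
abbrev FormField : Type _ := ∀ x : M, TangentSpace (𝓡 n) x →L[ℝ] TangentSpace (𝓡 n) x →L[ℝ] ℝ

/-- Fields of complex bivectors. -/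
abbrev CBivectorField : Type _ := ∀ x : M, CBivector (TangentSpace (𝓡 n) x)

variable {n M}

/-- The differential of a complex-valued function, as a complex covector. -/
def cdiff (u : M → ℂ) (x : M) : CCovector (TangentSpace (𝓡 n) x) :=
  mfderiv (𝓡 n) 𝓘(ℝ, ℂ) u x

/-- The differential of a real-valued function. -/
def rdiff (f : M → ℝ) (x : M) : TangentSpace (𝓡 n) x →L[ℝ] ℝ :=
  mfderiv (𝓡 n) 𝓘(ℝ, ℝ) f x

variable (n M)

/-- Smooth real bivector fields, i.e. smooth sections of `Λ² TM`, as fields of alternating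
bilinear forms on the cotangent spaces. Smoothness means that the coefficients in
local coordinates, equivalently the functions `Π(du, dv)` for local smooth functions `u, v`,
are smooth. -/
structure BivectorField where
  toFun : ∀ x : M, (TangentSpace (𝓡 n) x →L[ℝ] ℝ) →ₗ[ℝ] (TangentSpace (𝓡 n) x →L[ℝ] ℝ) →ₗ[ℝ] ℝ
  alternating : ∀ x α, toFun x α α = 0
  smooth : ∀ (U : Set M) (u v : M → ℝ), IsOpen U →
    ContMDiffOn (𝓡 n) 𝓘(ℝ, ℝ) ∞ u U → ContMDiffOn (𝓡 n) 𝓘(ℝ, ℝ) ∞ v U →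
    ContMDiffOn (𝓡 n) 𝓘(ℝ, ℝ) ∞ (fun x => toFun x (rdiff u x) (rdiff v x)) U

variable {n M}

/-- `u` is a `J`-holomorphic function on the open set `U`. -/
def IsHolomorphicOn (J : EndField n M) (u : M → ℂ) (U : Set M) : Prop :=
  ContMDiffOn (𝓡 n) 𝓘(ℝ, ℂ) ∞ u U ∧
    ∀ x ∈ U, ∀ v, cdiff (n := n) u x (J x v) = Complex.I * cdiff (n := n) u x v

/-- `J` is an integrable complex structure: around each point there are `J`-holomorphic
coordinates, i.e. `J`-holomorphic functions that together form an injective local diffeomorphism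
to some `ℂᵐ`. -/
def IsIntegrable (J : EndField n M) : Prop :=
  ∀ x : M, ∃ U : Set M, IsOpen U ∧ x ∈ U ∧ ∃ (m : ℕ) (z : Fin m → M → ℂ),
    (∀ k, IsHolomorphicOn J (z k) U) ∧
    Set.InjOn (fun y k => z k y) U ∧
    ∀ y ∈ U, Function.Bijective
      (fun (v : TangentSpace (𝓡 n) y) (k : Fin m) => cdiff (n := n) (z k) y v)

/-- The bracket `{u, v} = σ(du, dv)`. -/
def bracket (σ : CBivectorField n M) (u v : M → ℂ) : M → ℂ :=
  fun x => σ x (cdiff u x) (cdiff v x)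

/-- `σ` is a holomorphic bivector field on the complex manifold `(M, J)`: it has type `(2,0)`, and
its coefficients in holomorphic coordinates, equivalently its values `σ(du, dv)` on
the differentials of local holomorphic functions, are holomorphic. -/
def IsHolomorphicBivector (J : EndField n M) (σ : CBivectorField n M) : Prop :=
  (∀ x, IsType20 (J x) (σ x)) ∧
    ∀ (U : Set M) (u v : M → ℂ), IsOpen U → IsHolomorphicOn J u U → IsHolomorphicOn J v U →
      IsHolomorphicOn J (bracket σ u v) U

/-- The value `[σ, σ](du, dv, dw)` of the Schouten bracket, up to the conventional
factor `± 2`. -/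
def schoutenSelf (σ : CBivectorField n M) (u v w : M → ℂ) (x : M) : ℂ :=
  bracket σ u (bracket σ v w) x + bracket σ v (bracket σ w u) x + bracket σ w (bracket σ u v) x

/-- `σ` is a holomorphic Poisson bivector on the complex manifold `(M, J)`: it is holomorphic and
its Schouten bracket `[σ, σ]`, a holomorphic trivector, vanishes. (A holomorphic trivector is
determined by its values on the differentials of local holomorphic functions.) -/
def IsHolomorphicPoisson (J : EndField n M) (σ : CBivectorField n M) : Prop :=
  IsHolomorphicBivector J σ ∧
    ∀ (U : Set M) (u v w : M → ℂ), IsOpen U → IsHolomorphicOn J u U → IsHolomorphicOn J v U →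
      IsHolomorphicOn J w U → ∀ x ∈ U, schoutenSelf σ u v w x = 0

/-- Two holomorphic Poisson bivectors are compatible if all their linear combinations are
Poisson. -/
def AreCompatible (J : EndField n M) (σ τ : CBivectorField n M) : Prop :=
  ∀ s t : ℂ, IsHolomorphicPoisson J (fun x => s • σ x + t • τ x)

/-- Smoothness at `x` of a vector field. -/
def SmoothFieldAt [IsManifold (𝓡 n) ∞ M] (X : ∀ x : M, TangentSpace (𝓡 n) x) (x : M) : Prop :=
  ContMDiffAt (𝓡 n) (𝓡 n).tangent ∞ (fun y => (⟨y, X y⟩ : TangentBundle (𝓡 n) M)) x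

/-- The 2-form `η` is closed, by the invariant formula for `dη(X, Y, Z)`. -/
def IsClosedForm [IsManifold (𝓡 n) ∞ M] (η : FormField n M) : Prop :=
  ∀ (x : M) (X Y Z : ∀ x : M, TangentSpace (𝓡 n) x),
    SmoothFieldAt X x → SmoothFieldAt Y x → SmoothFieldAt Z x →
    rdiff (n := n) (fun y => η y (Y y) (Z y)) x (X x)
      + rdiff (n := n) (fun y => η y (Z y) (X y)) x (Y x)
      + rdiff (n := n) (fun y => η y (X y) (Y y)) x (Z x)
      - η x (VectorField.mlieBracket (𝓡 n) X Y x) (Z x)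
      - η x (VectorField.mlieBracket (𝓡 n) Y Z x) (X x)
      - η x (VectorField.mlieBracket (𝓡 n) Z X x) (Y x) = 0

variable (n M)

/-- A hypercomplex structure `(I₁, I₂, I₃)`. The indices `1, 2, 3` are `0, 1, 2 : Fin 3`. -/
structure HypercomplexStructure [IsManifold (𝓡 n) ∞ M] where
  J : Fin 3 → EndField n M
  smooth : ∀ a, ContMDiff (𝓡 n)
    ((𝓡 n).prod 𝓘(ℝ, EuclideanSpace ℝ (Fin n) →L[ℝ] EuclideanSpace ℝ (Fin n))) ∞
    (fun x => TotalSpace.mk' (EuclideanSpace ℝ (Fin n) →L[ℝ] EuclideanSpace ℝ (Fin n))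
      (E := fun x : M => TangentSpace (𝓡 n) x →L[ℝ] TangentSpace (𝓡 n) x) x (J a x))
  sq : ∀ a x v, J a x (J a x v) = -v
  mul : ∀ x v, J 0 x (J 1 x v) = J 2 x v
  integrable : ∀ a, IsIntegrable (J a)

/-- A hyperkähler structure `(g, I₁, I₂, I₃)`: a Riemannian metric that is Kähler with respect to
each of the complex structures of a hypercomplex structure. -/
structure HyperkahlerStructure [IsManifold (𝓡 n) ∞ M] extends HypercomplexStructure n M where
  metric : ContMDiffRiemannianMetric (𝓡 n) ∞ (EuclideanSpace ℝ (Fin n))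
    (fun x : M => TangentSpace (𝓡 n) x)
  hermitian : ∀ a x v w, metric.inner x (J a x v) (J a x w) = metric.inner x v w
  closed : ∀ a, IsClosedForm (fun x => (metric.inner x).comp (J a x))

variable {n M} [IsManifold (𝓡 n) ∞ M]

/-- The complex structure `a₁ I₁ + a₂ I₂ + a₃ I₃` determined by a point `a` of the unit sphere. -/
def HypercomplexStructure.complexStructure (hc : HypercomplexStructure n M) (a : Fin 3 → ℝ) :
    EndField n M :=
  fun x => ∑ i, a i • hc.J i x

/-- The Kähler form `ω_a = g(I_a ·, ·)`. -/
def HyperkahlerStructure.kahlerForm (hk : HyperkahlerStructure n M) (a : Fin 3) : FormField n M :=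
  fun x => (hk.metric.inner x).comp (hk.J a x)

/-- The form `∑ bᵢ ωᵢ + i ∑ cᵢ ωᵢ`. For `b, c` orthonormal this is the parallel holomorphic
symplectic form of the complex structure `b × c`; the choice of `b, c` for a given `b × c` changes
it by a constant factor of modulus one. -/
def HyperkahlerStructure.holSymplectic (hk : HyperkahlerStructure n M) (b c : Fin 3 → ℝ) (x : M)
    (X : TangentSpace (𝓡 n) x) : CCovector (TangentSpace (𝓡 n) x) :=
  ∑ i, ((b i : ℂ) + (c i : ℂ) * Complex.I) • Complex.ofRealCLM.comp (hk.kahlerForm i x X)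

/-- The field of `(2,0)`-components of a real bivector field. -/
def BivectorField.component20 (P : BivectorField n M) (J : EndField n M) : CBivectorField n M :=
  fun x => HyperPoisson.component20 (J x) (complexify (P.toFun x))

/-- Hyper-Poisson bivectors on a hypercomplex manifold. -/
def IsHyperPoisson (hc : HypercomplexStructure n M) (P : BivectorField n M) : Prop :=
  (∀ x, complexify (P.toFun x) ∈ lambda2E_S2H (fun a => hc.J a x)) ∧
    ∀ a : Fin 3 → ℝ, a ⬝ᵥ a = 1 →
      IsHolomorphicPoisson (hc.complexStructure a) (P.component20 (hc.complexStructure a))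

/-- Compatibility of a hyper-Poisson bivector with the hyperkähler structure: for each complex
structure `I`, its `(2,0)`-component is compatible with `Ω⁻¹`, where `Ω` is the
corresponding parallel holomorphic symplectic form. -/
def IsCompatibleWith (hk : HyperkahlerStructure n M) (P : BivectorField n M) : Prop :=
  ∀ b c : Fin 3 → ℝ, b ⬝ᵥ b = 1 → c ⬝ᵥ c = 1 → b ⬝ᵥ c = 0 →
    ∃ Q : CBivectorField n M,
      (∀ x, IsInverse20 (hk.complexStructure (b ⨯₃ c) x) (hk.holSymplectic b c x) (Q x)) ∧
      AreCompatible (hk.complexStructure (b ⨯₃ c))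
        (P.component20 (hk.complexStructure (b ⨯₃ c))) Q

end Manifold

end HyperPoisson

end

open HyperPoisson

/-! In real dimension four, `E` is a complex plane, so `Λ²E` is a line and `Λ²E ⊗ S²H` has rank
three; it is spanned by the three bivectors `ω_a⁻¹`. Condition (i) therefore says exactly that `Π =
∑ f_a ω_a⁻¹` (`complexify_mem_lambda2E_S2H`, `eq_sum_inverseBivector_of_mem`).

Let `b, c` be orthonormal with `b × c = ζ`, and put `F = ∑ f_a (b_a + i c_a)`. Since `ω_ζ⁻¹` has
type (1,1), the (2,0)-component of `Π` is `2 F Ω⁻¹` (`component20_eq_mul_holPoisson`). As `Ω⁻¹` is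
holomorphic and has no zeros, this component is holomorphic iff `F` is. If `θ` is the common value
of the `I_a df_a`, then `dF = -(θ ∘ I_b + i θ ∘ I_c)`, which has type (1,0) by the quaternion
relations. Conversely, holomorphy of `F` for `ζ` on the first two axes already gives `I_1 df_1 = I_2
df_2 = I_3 df_3`.

It remains that `h Ω⁻¹` is holomorphic Poisson for every holomorphic `h`
(`isHolomorphicPoisson_of_eq_mul`). The tool is the identity `α ∧ β = Ω⁻¹(α, β) Ω` for covectors of
type (1,0). Let `{u, v} = Ω⁻¹(du, dv)`. Applied to `du ∧ dv`, the identity and `dΩ = 0` give `d{u,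
v} ∧ Ω = 0`, which forces `{u, v}` to be holomorphic. The Jacobi identity comes from differentiating
the linear relation among three (1,0)-covectors in a two-dimensional space. Compatibility is the
same statement for `h = 2 s F + t`. -/

namespace HyperPoisson

/-! ### Quaternionic hermitian linear algebra in real dimension four. -/

section Triple

variable {V : Type*} [AddCommGroup V] [Module ℝ V] [TopologicalSpace V]

/-- A quaternionic hermitian structure on a vector space: a positive definite form `g`, together with
`g`-orthogonal complex structures that satisfy `I J = K = - J I`. -/
structure IsQuaternionTriple (g : V →L[ℝ] V →L[ℝ] ℝ) (I J K : V →L[ℝ] V) : Prop where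
  symm : ∀ v w, g v w = g w v
  pos : ∀ v, v ≠ 0 → 0 < g v v
  sqI : ∀ v, I (I v) = -v
  sqJ : ∀ v, J (J v) = -v
  mulIJ : ∀ v, I (J v) = K v
  mulJI : ∀ v, J (I v) = -K v
  hermI : ∀ v w, g (I v) (I w) = g v w
  hermJ : ∀ v w, g (J v) (J w) = g v w

namespace IsQuaternionTriple

variable {g : V →L[ℝ] V →L[ℝ] ℝ} {I J K : V →L[ℝ] V}

theorem mulIK (h : IsQuaternionTriple g I J K) (v : V) : I (K v) = -J v := by
  rw [← h.mulIJ, h.sqI]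

theorem mulKI (h : IsQuaternionTriple g I J K) (v : V) : K (I v) = J v := by
  rw [← h.mulIJ, h.mulJI, map_neg, h.mulIK, neg_neg]

theorem mulJK (h : IsQuaternionTriple g I J K) (v : V) : J (K v) = I v := by
  rw [← neg_neg (K v), ← h.mulJI, map_neg, h.sqJ, neg_neg]

theorem mulKJ (h : IsQuaternionTriple g I J K) (v : V) : K (J v) = -I v := by
  rw [← h.mulIJ, h.sqJ, map_neg]

theorem sqK (h : IsQuaternionTriple g I J K) (v : V) : K (K v) = -v := by
  rw [← h.mulIJ (K v), h.mulJK, h.sqI]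

theorem hermK (h : IsQuaternionTriple g I J K) (v w : V) : g (K v) (K w) = g v w := by
  rw [← h.mulIJ, ← h.mulIJ, h.hermI, h.hermJ]

/-- Cyclic permutations of a quaternionic triple are quaternionic triples. -/
theorem rotate (h : IsQuaternionTriple g I J K) : IsQuaternionTriple g J K I :=
  ⟨h.symm, h.pos, h.sqJ, h.sqK, h.mulJK, h.mulKJ, h.hermJ, h.hermK⟩

theorem skewI (h : IsQuaternionTriple g I J K) (v w : V) : g (I v) w = -g v (I w) := by
  rw [← h.hermI v (I w), h.sqI, map_neg, neg_neg]

theorem skewJ (h : IsQuaternionTriple g I J K) (v w : V) : g (J v) w = -g v (J w) :=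
  h.rotate.skewI v w

theorem skewK (h : IsQuaternionTriple g I J K) (v w : V) : g (K v) w = -g v (K w) :=
  h.rotate.rotate.skewI v w

theorem apply_I_self (h : IsQuaternionTriple g I J K) (v : V) : g v (I v) = 0 := by
  have h1 := h.skewI v v
  rw [h.symm] at h1
  linarith

theorem apply_J_self (h : IsQuaternionTriple g I J K) (v : V) : g v (J v) = 0 :=
  h.rotate.apply_I_self v

theorem apply_K_self (h : IsQuaternionTriple g I J K) (v : V) : g v (K v) = 0 :=
  h.rotate.rotate.apply_I_self v

theorem apply_I_J (h : IsQuaternionTriple g I J K) (v : V) : g (I v) (J v) = 0 := by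
  rw [h.skewI, h.mulIJ, h.apply_K_self, neg_zero]

theorem apply_J_K (h : IsQuaternionTriple g I J K) (v : V) : g (J v) (K v) = 0 :=
  h.rotate.apply_I_J v

theorem apply_I_K (h : IsQuaternionTriple g I J K) (v : V) : g (I v) (K v) = 0 := by
  rw [h.symm]; exact h.rotate.rotate.apply_I_J v

/-- The four vectors are pairwise orthogonal and of equal length, so pairing a relation with each of
them isolates one coefficient. -/
theorem linearIndependent (h : IsQuaternionTriple g I J K) {v : V} (hv : v ≠ 0) :
    LinearIndependent ℝ ![v, I v, J v, K v] := by
  have hp := (h.pos v hv).ne'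
  rw [Fintype.linearIndependent_iff]
  intro c hc
  simp only [Fin.sum_univ_four, Matrix.cons_val] at hc
  have h0 := congrArg (g v) hc
  have h1 := congrArg (g (I v)) hc
  have h2 := congrArg (g (J v)) hc
  have h3 := congrArg (g (K v)) hc
  simp only [map_add, map_smul, smul_eq_mul, map_zero, h.apply_I_self, h.apply_J_self,
    h.apply_K_self, h.apply_I_J, h.apply_J_K, h.apply_I_K, h.symm _ v, h.symm (J v) (I v),
    h.symm (K v) (I v), h.symm (K v) (J v), h.hermI, h.hermJ, h.hermK, mul_zero, add_zero,
    zero_add, mul_eq_zero, hp, or_false] at h0 h1 h2 h3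
  intro i
  fin_cases i <;> assumption

/-- Expansion in the orthogonal frame `v, I v, J v, K v`. -/
theorem expand (h : IsQuaternionTriple g I J K) (hd : Module.finrank ℝ V = 4) {v : V} (hv : v ≠ 0)
    (X : V) :
    X = (g v v)⁻¹ • (g v X • v + g (I v) X • I v + g (J v) X • J v + g (K v) X • K v) := by
  have hp := (h.pos v hv).ne'
  let b := basisOfLinearIndependentOfCardEqFinrank (h.linearIndependent hv) (by simp [hd])
  have hX := b.sum_repr X
  simp only [b, coe_basisOfLinearIndependentOfCardEqFinrank, Fin.sum_univ_four,
    Matrix.cons_val] at hX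
  generalize (basisOfLinearIndependentOfCardEqFinrank (h.linearIndependent hv) _).repr X = c at hX
  have h0 := congrArg (g v) hX
  have h1 := congrArg (g (I v)) hX
  have h2 := congrArg (g (J v)) hX
  have h3 := congrArg (g (K v)) hX
  simp only [map_add, map_smul, smul_eq_mul, h.apply_I_self, h.apply_J_self,
    h.apply_K_self, h.apply_I_J, h.apply_J_K, h.apply_I_K, h.symm _ v, h.symm (J v) (I v),
    h.symm (K v) (I v), h.symm (K v) (J v), h.hermI, h.hermJ, h.hermK, mul_zero, add_zero,
    zero_add] at h0 h1 h2 h3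
  rw [← h0, h.symm (I v), h.symm (J v), h.symm (K v), h.symm X, h.symm X, h.symm X,
    ← h1, ← h2, ← h3]
  simp only [mul_smul, mul_comm _ (g v v), ← smul_add]
  rw [smul_smul, inv_mul_cancel₀ hp, one_smul, hX]

theorem exists_dual (h : IsQuaternionTriple g I J K) (hd : Module.finrank ℝ V = 4) {v : V}
    (hv : v ≠ 0) (α : V →L[ℝ] ℝ) :
    g ((g v v)⁻¹ • (α v • v + α (I v) • I v + α (J v) • J v + α (K v) • K v)) = α := by
  ext X
  conv_rhs => rw [h.expand hd hv X]
  simp only [map_add, map_smul, add_apply, smul_apply,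
    smul_eq_mul]
  ring

section Inverse

variable [IsTopologicalAddGroup V] [ContinuousSMul ℝ V] [T2Space V] [FiniteDimensional ℝ V]

/-- `ContinuousLinearMap.inverse` is zero on non-invertible maps, so `g.comp I` must first be shown
bijective: positivity gives injectivity and `exists_dual` gives surjectivity. The value then follows
from `I² = -1`. -/
theorem inverse_comp (h : IsQuaternionTriple g I J K) (hd : Module.finrank ℝ V = 4) {s : V}
    {α : V →L[ℝ] ℝ} (hs : g s = α) : (g.comp I).inverse α = -I s := by
  have hinj : Function.Injective (g.comp I : V →ₗ[ℝ] V →L[ℝ] ℝ) := by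
    rw [← LinearMap.ker_eq_bot, LinearMap.ker_eq_bot']
    intro m hm
    by_contra hne
    have h1 := congrArg (fun f : V →L[ℝ] ℝ => f (I m)) hm
    simp only [ContinuousLinearMap.coe_coe, ContinuousLinearMap.comp_apply, h.hermI,
      zero_apply] at h1
    exact (h.pos m hne).ne' h1
  have hsurj : Function.Surjective (g.comp I : V →ₗ[ℝ] V →L[ℝ] ℝ) := by
    intro β
    by_cases hV : ∃ v : V, v ≠ 0
    · obtain ⟨v, hv⟩ := hV
      refine ⟨-I ((g v v)⁻¹ • (β v • v + β (I v) • I v + β (J v) • J v + β (K v) • K v)), ?_⟩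
      rw [ContinuousLinearMap.coe_coe, ContinuousLinearMap.comp_apply, map_neg, h.sqI, neg_neg,
        h.exists_dual hd hv]
    · push Not at hV
      exact ⟨0, by ext X; rw [hV X]; simp⟩
  let e := LinearEquiv.ofBijective (g.comp I : V →ₗ[ℝ] V →L[ℝ] ℝ) ⟨hinj, hsurj⟩
  have : g.comp I = (e.toContinuousLinearEquiv : V →L[ℝ] V →L[ℝ] ℝ) := by ext; rfl
  rw [this, ContinuousLinearMap.inverse_equiv]
  apply e.toContinuousLinearEquiv.injective
  simp only [ContinuousLinearEquiv.coe_coe, ContinuousLinearEquiv.apply_symm_apply]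
  change α = g (I (-I s))
  rw [map_neg, h.sqI, neg_neg, hs]

theorem inverseBivector_apply (h : IsQuaternionTriple g I J K) (hd : Module.finrank ℝ V = 4)
    (s t : V) : inverseBivector (g.comp I) (g s) (g t) = g (I s) t := by
  rw [inverseBivector, h.inverse_comp hd rfl, h.inverse_comp hd rfl, ContinuousLinearMap.comp_apply,
    map_neg I, h.sqI, neg_neg, map_neg (g s), h.skewI]

/-- The inverse of the form `g (I ·, ·)` in the frame `v, I v, J v, K v`. -/
theorem inverseBivector_frame (h : IsQuaternionTriple g I J K) (hd : Module.finrank ℝ V = 4)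
    {v : V} (hv : v ≠ 0) (α β : V →L[ℝ] ℝ) :
    inverseBivector (g.comp I) α β =
      (g v v)⁻¹ * (α v * β (I v) - α (I v) * β v + α (J v) * β (K v) - α (K v) * β (J v)) := by
  have hα := h.exists_dual hd hv α
  have hβ := h.exists_dual hd hv β
  conv_lhs => rw [← hα, ← hβ]
  rw [h.inverseBivector_apply hd, h.symm, hβ]
  simp only [map_add, map_smul, smul_eq_mul, h.sqI, h.mulIJ, h.mulIK, map_neg]
  ring

end Inverse

end IsQuaternionTriple

end Triple

/-! ### Complexified bivectors and the summand `Λ²E ⊗ S²H` at a point. -/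

section Pointwise

variable {V : Type*} [AddCommGroup V] [Module ℝ V] [TopologicalSpace V]

theorem complexify_apply (P : (V →L[ℝ] ℝ) →ₗ[ℝ] (V →L[ℝ] ℝ) →ₗ[ℝ] ℝ) (α β : CCovector V) :
    complexify P α β = ⟨P (rePart α) (rePart β) - P (imPart α) (imPart β),
        P (rePart α) (imPart β) + P (imPart α) (rePart β)⟩ := rfl

theorem complexify_ofReal (P : (V →L[ℝ] ℝ) →ₗ[ℝ] (V →L[ℝ] ℝ) →ₗ[ℝ] ℝ) (α β : V →L[ℝ] ℝ) :
    complexify P (Complex.ofRealCLM.comp α) (Complex.ofRealCLM.comp β) = P α β := by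
  have hre : ∀ γ : V →L[ℝ] ℝ, rePart (Complex.ofRealCLM.comp γ) = γ := fun γ => by
    ext; simp [rePart]
  have him : ∀ γ : V →L[ℝ] ℝ, imPart (Complex.ofRealCLM.comp γ) = 0 := fun γ => by
    ext; simp [imPart]
  rw [complexify_apply, hre, hre, him, him]
  apply Complex.ext <;> simp

theorem complexify_self {P : (V →L[ℝ] ℝ) →ₗ[ℝ] (V →L[ℝ] ℝ) →ₗ[ℝ] ℝ} (hP : ∀ α, P α α = 0)
    (α : CCovector V) : complexify P α α = 0 := by
  have hs := hP (rePart α + imPart α)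
  simp only [map_add, LinearMap.add_apply, hP] at hs
  rw [complexify_apply]
  apply Complex.ext
  · simp [hP]
  · simp only [Complex.zero_im]; linarith

@[simp]
theorem pair_tmul (α : CCovector V) (c : ℂ) (v : V) : pair α (c ⊗ₜ[ℝ] v) = c * α v := by
  simp [pair]

theorem wedge_apply (Z W : ℂ ⊗[ℝ] V) (α β : CCovector V) :
    wedge Z W α β = pair α Z * pair β W - pair α W * pair β Z := rfl

theorem pair_comp (α : CCovector V) (A : V →L[ℝ] V) (Z : ℂ ⊗[ℝ] V) :
    pair (α.comp A) Z = pair α (LinearMap.baseChange ℂ (A : V →ₗ[ℝ] V) Z) := by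
  induction Z using TensorProduct.induction_on with
  | zero => simp
  | tmul c v => simp
  | add x y hx hy => rw [map_add, map_add, map_add, hx, hy]

theorem component20_apply (J : V →L[ℝ] V) (σ : CBivector V) (α β : CCovector V) :
    component20 J σ α β = σ (proj10 J α) (proj10 J β) := rfl

theorem proj10_of_type10 {J : V →L[ℝ] V} {α : CCovector V} (hα : ∀ v, α (J v) = Complex.I * α v) :
    proj10 J α = α := by
  ext v
  change (2⁻¹ : ℂ) * (α v - Complex.I * α (J v)) = α v
  rw [hα]
  linear_combination (-2⁻¹ * α v) * Complex.I_mul_I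

/-- The `(2,0)`-component has type `(2,0)`. -/
theorem isType20_component20 {J : V →L[ℝ] V} (hJ : ∀ v, J (J v) = -v) {σ : CBivector V}
    (hσ : ∀ α, σ α α = 0) : IsType20 J (component20 J σ) := by
  refine ⟨fun α => hσ _, fun α β => ?_⟩
  have : proj10 J (α.comp J) = Complex.I • proj10 J α := by
    ext v
    change (2⁻¹ : ℂ) * (α (J v) - Complex.I * α (J (J v))) =
      Complex.I * ((2⁻¹ : ℂ) * (α v - Complex.I * α (J v)))
    rw [hJ, map_neg]
    linear_combination (2⁻¹ * α (J v)) * Complex.I_mul_I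
  rw [component20_apply, this, map_smul, LinearMap.smul_apply, smul_eq_mul, component20_apply]

/-- The Casimir operator of `Sp(1)` acts on `Λ² E ⊗ S² H` as `-1`. -/
theorem sum_comp_of_mem_lambda2E_S2H {J : Fin 3 → V →L[ℝ] V} {σ : CBivector V}
    (hσ : σ ∈ lambda2E_S2H J) (α β : CCovector V) :
    ∑ a, σ (α.comp (J a)) (β.comp (J a)) = -σ α β := by
  induction hσ using Submodule.span_induction with
  | zero => simp
  | add x y _ _ hx hy =>
    simp only [LinearMap.add_apply, Finset.sum_add_distrib, hx, hy]; ring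
  | smul c x _ hx =>
    simp only [LinearMap.smul_apply, ← Finset.smul_sum, hx, smul_neg]
  | mem σ hσ =>
    obtain ⟨φ, ψ, hφ, hψ, h, k, rfl⟩ := hσ
    -- On `H ⊗ H` the operator `∑ i_a ⊗ i_a` is `-1` on `S²H` and `3` on `Λ²H`. Expanding everything
    -- in the basis of `H` turns this into a polynomial identity.
    have key : ∀ (γ : CCovector V) (χ : (Fin 2 → ℂ) →ₗ[ℂ] ℂ ⊗[ℝ] V) (l : Fin 2 → ℂ),
        pair γ (χ l) = l 0 * pair γ (χ (Pi.single 0 1)) + l 1 * pair γ (χ (Pi.single 1 1)) := by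
      intro γ χ l
      have hl : l = l 0 • Pi.single 0 1 + l 1 • Pi.single 1 1 := by
        ext i; fin_cases i <;> simp
      conv_lhs => rw [hl]
      simp only [map_add, map_smul, smul_eq_mul]
    have key' : ∀ (γ : CCovector V) (χ : (Fin 2 → ℂ) →ₗ[ℂ] ℂ ⊗[ℝ] V), IsInE J χ → ∀ a l,
        pair (γ.comp (J a)) (χ l) = (quaternionAction a *ᵥ l) 0 * pair γ (χ (Pi.single 0 1))
          + (quaternionAction a *ᵥ l) 1 * pair γ (χ (Pi.single 1 1)) := by
      intro γ χ hχ a l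
      rw [pair_comp, ← hχ, key]
    simp only [LinearMap.add_apply, wedge_apply, key' _ _ hφ, key' _ _ hψ]
    rw [key α φ h, key β φ h, key α ψ h, key β ψ h, key α φ k, key β φ k, key α ψ k,
      key β ψ k]
    simp only [Fin.sum_univ_three, quaternionAction, Matrix.cons_val, Matrix.mulVec,
      dotProduct, Fin.sum_univ_two, Matrix.of_apply, Matrix.cons_val_zero, Matrix.cons_val_one]
    ring_nf
    simp only [Complex.I_sq]
    ring

/-- The element of `E` that sends the first basis vector of `H` to `v - i I v`. -/
noncomputable def quaternionHom (J : Fin 3 → V →L[ℝ] V) (v : V) : (Fin 2 → ℂ) →ₗ[ℂ] ℂ ⊗[ℝ] V :=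
  (LinearMap.proj 0).smulRight (1 ⊗ₜ[ℝ] v - Complex.I ⊗ₜ[ℝ] J 0 v) -
    (LinearMap.proj 1).smulRight (1 ⊗ₜ[ℝ] J 1 v + Complex.I ⊗ₜ[ℝ] J 2 v)

theorem quaternionHom_apply (J : Fin 3 → V →L[ℝ] V) (v : V) (h : Fin 2 → ℂ) :
    quaternionHom J v h = h 0 • (1 ⊗ₜ[ℝ] v - Complex.I ⊗ₜ[ℝ] J 0 v) -
      h 1 • (1 ⊗ₜ[ℝ] J 1 v + Complex.I ⊗ₜ[ℝ] J 2 v) := rfl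

/-- The vector `v - i J₀ v` is an eigenvector of `J 0` for `i`, as is the first basis vector of `H`
for the matrix of `J 0`. The matrix of `J 1` then forces the second value to be `-J₁` of the first.
-/
theorem isInE_quaternionHom {g : V →L[ℝ] V →L[ℝ] ℝ} {J : Fin 3 → V →L[ℝ] V}
    (hJ : IsQuaternionTriple g (J 0) (J 1) (J 2)) (v : V) : IsInE J (quaternionHom J v) := by
  intro a h
  fin_cases a <;>
  · simp only [quaternionHom_apply, map_sub, map_add, LinearMap.baseChange_tmul,
      ContinuousLinearMap.coe_coe, quaternionAction, Matrix.cons_val, Matrix.mulVec,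
      dotProduct, Fin.sum_univ_two, Matrix.of_apply, Matrix.cons_val_zero, Matrix.cons_val_one,
      Fin.zero_eta, Fin.mk_one, Fin.reduceFinMk,
      hJ.sqI, hJ.sqJ, hJ.sqK, hJ.mulIJ, hJ.mulJI, hJ.mulIK, hJ.mulKI, hJ.mulJK, hJ.mulKJ,
      TensorProduct.tmul_neg, smul_sub, smul_add, TensorProduct.smul_tmul', smul_eq_mul, mul_one,
      TensorProduct.neg_tmul, zero_mul, neg_mul, one_mul, zero_add, add_zero,
      mul_right_comm _ _ Complex.I, Complex.I_mul_I]
    simp only [mul_comm (h _) Complex.I]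
    abel

section Combination

variable [IsTopologicalAddGroup V] [ContinuousSMul ℝ V] [T2Space V] [FiniteDimensional ℝ V]
  {g : V →L[ℝ] V →L[ℝ] ℝ} {J : Fin 3 → V →L[ℝ] V}
  {P : (V →L[ℝ] ℝ) →ₗ[ℝ] (V →L[ℝ] ℝ) →ₗ[ℝ] ℝ} {f : Fin 3 → ℝ}

/-- The complex extension of `∑ f_a ω_a⁻¹` in the frame `v, J₀ v, J₁ v, J₂ v`. -/
theorem complexify_frame (hJ : IsQuaternionTriple g (J 0) (J 1) (J 2))
    (hd : Module.finrank ℝ V = 4)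
    (hP : ∀ α β, P α β = ∑ a, f a * inverseBivector (g.comp (J a)) α β) {v : V} (hv : v ≠ 0)
    (α β : CCovector V) :
    complexify P α β = ((g v v)⁻¹ : ℂ) *
      (f 0 * (α v * β (J 0 v) - α (J 0 v) * β v + α (J 1 v) * β (J 2 v) - α (J 2 v) * β (J 1 v)) +
       f 1 * (α v * β (J 1 v) - α (J 1 v) * β v + α (J 2 v) * β (J 0 v) - α (J 0 v) * β (J 2 v)) +
       f 2 * (α v * β (J 2 v) - α (J 2 v) * β v + α (J 0 v) * β (J 1 v) - α (J 1 v) * β (J 0 v)))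
      := by
  simp only [complexify_apply, hP, Fin.sum_univ_three, hJ.inverseBivector_frame hd hv,
    hJ.rotate.inverseBivector_frame hd hv, hJ.rotate.rotate.inverseBivector_frame hd hv, rePart,
    imPart, ContinuousLinearMap.comp_apply, Complex.reCLM_apply, Complex.imCLM_apply]
  rw [← Complex.ofReal_inv]
  apply Complex.ext <;>
  · simp only [Complex.mul_re, Complex.mul_im, Complex.add_re, Complex.add_im, Complex.sub_re,
      Complex.sub_im, Complex.ofReal_re, Complex.ofReal_im]
    ring

/-- The combinations `∑ f_a ω_a⁻¹` are sections of `Λ² E ⊗ S² H`. -/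
theorem complexify_mem_lambda2E_S2H (hJ : IsQuaternionTriple g (J 0) (J 1) (J 2))
    (hd : Module.finrank ℝ V = 4)
    (hP : ∀ α β, P α β = ∑ a, f a * inverseBivector (g.comp (J a)) α β) :
    complexify P ∈ lambda2E_S2H J := by
  have : Nontrivial V := Module.nontrivial_of_finrank_pos (R := ℝ) (by omega)
  obtain ⟨v, hv⟩ := exists_ne (0 : V)
  let φ := quaternionHom J v
  let ψ := quaternionHom J (J 1 v)
  let e : Fin 2 → Fin 2 → ℂ := fun i => Pi.single i 1
  let τ : Fin 2 → Fin 2 → CBivector V := fun i j =>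
    wedge (φ (e i)) (ψ (e j)) + wedge (φ (e j)) (ψ (e i))
  have hτ : ∀ i j, τ i j ∈ lambda2E_S2H J := fun i j => Submodule.subset_span
    ⟨φ, ψ, isInE_quaternionHom hJ v, isInE_quaternionHom hJ (J 1 v), e i, e j, rfl⟩
  -- `φ` and `ψ` come from `v` and `J 1 v`. Up to constants, `ω₀⁻¹` corresponds to `e₀e₁` in `S²H`,
  -- the line fixed by `J 0`, while `e₀²` and `e₁²` give `ω₁⁻¹ - i ω₂⁻¹` and `ω₁⁻¹ + i ω₂⁻¹`.
  have hsum : complexify P = ((g v v)⁻¹ : ℂ) • ((-(f 0) * Complex.I / 2) • τ 0 1 +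
      ((f 1 + f 2 * Complex.I) / 4) • τ 0 0 + ((f 1 - f 2 * Complex.I) / 4) • τ 1 1) := by
    refine LinearMap.ext₂ fun α β => ?_
    rw [complexify_frame hJ hd hP hv]
    simp only [τ, φ, ψ, e, LinearMap.smul_apply, LinearMap.add_apply, smul_eq_mul, wedge_apply,
      quaternionHom_apply, map_sub, map_add, map_smul, pair_tmul, hJ.sqJ, hJ.mulIJ, hJ.mulKJ,
      map_neg, Pi.single_apply, Fin.zero_ne_one, if_false, if_true, one_ne_zero]
    ring_nf
    simp only [Complex.I_sq]
    ring_nf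
  rw [hsum]
  exact Submodule.smul_mem _ _ (add_mem (add_mem (Submodule.smul_mem _ _ (hτ _ _))
    (Submodule.smul_mem _ _ (hτ _ _))) (Submodule.smul_mem _ _ (hτ _ _)))

/-- The Casimir identity on the pairs `(v, J_a v)` is a self-duality: it equates, up to sign, the
six frame components of `P` in pairs. The three that survive are the coefficients of the `ω_a⁻¹`. -/
theorem eq_sum_inverseBivector_of_mem (hJ : IsQuaternionTriple g (J 0) (J 1) (J 2))
    (hd : Module.finrank ℝ V = 4) (hP : ∀ α, P α α = 0)
    (hmem : complexify P ∈ lambda2E_S2H J) {v : V} (hv : v ≠ 0) (α β : V →L[ℝ] ℝ) :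
    P α β = ∑ a, (P (g v) (g (J a v)) / g v v) * inverseBivector (g.comp (J a)) α β := by
  have hp := (hJ.pos v hv).ne'
  have hsymm : ∀ α β, P β α = -P α β := by
    intro α β
    have hs := hP (α + β)
    simp only [map_add, LinearMap.add_apply, hP] at hs
    linarith
  have hcas : ∀ α β : V →L[ℝ] ℝ, ∑ a, P (α.comp (J a)) (β.comp (J a)) = -P α β := by
    intro α β
    have h := sum_comp_of_mem_lambda2E_S2H hmem (Complex.ofRealCLM.comp α)
      (Complex.ofRealCLM.comp β)
    simp only [ContinuousLinearMap.comp_assoc, complexify_ofReal] at h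
    exact_mod_cast h
  have hcomp : ∀ w, (g w).comp (J 0) = -g (J 0 w) ∧ (g w).comp (J 1) = -g (J 1 w) ∧
      (g w).comp (J 2) = -g (J 2 w) := by
    intro w
    refine ⟨?_, ?_, ?_⟩ <;> ext X
    · simp [hJ.skewI]
    · simp [hJ.skewJ]
    · simp [hJ.skewK]
  have h1 := hcas (g v) (g (J 0 v))
  have h2 := hcas (g v) (g (J 1 v))
  have h3 := hcas (g v) (g (J 2 v))
  simp only [Fin.sum_univ_three, hcomp, hJ.sqI, hJ.sqJ, hJ.sqK, hJ.mulIJ, hJ.mulJI, hJ.mulIK,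
    hJ.mulKI, hJ.mulJK, hJ.mulKJ, map_neg, neg_neg, LinearMap.neg_apply] at h1 h2 h3
  rw [hsymm (g v) (g (J 0 v)), hsymm (g (J 1 v)) (g (J 2 v))] at h1
  rw [hsymm (g v) (g (J 1 v)), hsymm (g (J 0 v)) (g (J 2 v))] at h2
  rw [hsymm (g v) (g (J 2 v)), hsymm (g (J 0 v)) (g (J 1 v))] at h3
  have e1 : P (g (J 1 v)) (g (J 2 v)) = P (g v) (g (J 0 v)) := by linarith
  have e2 : P (g (J 0 v)) (g (J 2 v)) = -P (g v) (g (J 1 v)) := by linarith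
  have e3 : P (g (J 0 v)) (g (J 1 v)) = P (g v) (g (J 2 v)) := by linarith
  simp only [Fin.sum_univ_three, hJ.inverseBivector_frame hd hv,
    hJ.rotate.inverseBivector_frame hd hv, hJ.rotate.rotate.inverseBivector_frame hd hv]
  conv_lhs => rw [← hJ.exists_dual hd hv α, ← hJ.exists_dual hd hv β]
  simp only [map_add, map_smul, LinearMap.add_apply, LinearMap.smul_apply, smul_eq_mul, hP,
    hsymm (g v), hsymm (g (J 0 v)) (g (J 1 v)), hsymm (g (J 0 v)) (g (J 2 v)),
    hsymm (g (J 1 v)) (g (J 2 v)), e1, e2, e3]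
  field_simp
  ring

/-- The formula holds for every nonzero `v`, so the coefficients do not depend on the frame and may
be computed along a smooth field. -/
theorem coefficient_eq (hJ : IsQuaternionTriple g (J 0) (J 1) (J 2))
    (hd : Module.finrank ℝ V = 4)
    (hP : ∀ α β, P α β = ∑ a, f a * inverseBivector (g.comp (J a)) α β) {v : V} (hv : v ≠ 0)
    (a : Fin 3) : f a = P (g v) (g (J a v)) / g v v := by
  have hp := (hJ.pos v hv).ne'
  rw [eq_div_iff hp, hP, Fin.sum_univ_three, hJ.inverseBivector_apply hd,
    hJ.rotate.inverseBivector_apply hd, hJ.rotate.rotate.inverseBivector_apply hd]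
  fin_cases a <;> simp [hJ.hermI, hJ.hermJ, hJ.hermK, hJ.apply_I_J, hJ.apply_J_K, hJ.apply_I_K,
    hJ.symm (J 1 v) (J 0 v), hJ.symm (J 2 v) (J 0 v), hJ.symm (J 2 v) (J 1 v)]

end Combination

end Pointwise

/-! ### Covectors of type (1,0), the form `Ω` and its inverse, and rotated triples. -/

section Pointwise

variable {V : Type*} [AddCommGroup V] [Module ℝ V] [TopologicalSpace V]

/-- The bivector of type `(2,0)` with respect to `I` that is dual to the form
`g (J ·, ·) + i g (K ·, ·)`, for a quaternionic triple `I, J, K` and a nonzero vector `v`. -/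
noncomputable def symplecticInverse (g : V →L[ℝ] V →L[ℝ] ℝ) (I J : V →L[ℝ] V) (v : V) :
    CBivector V :=
  component20 I (((g v v)⁻¹ : ℂ) • wedge (1 ⊗ₜ[ℝ] v) (1 ⊗ₜ[ℝ] J v))

section Symplectic

variable {g : V →L[ℝ] V →L[ℝ] ℝ} {I J K : V →L[ℝ] V} {v : V} {α β : CCovector V}
  {Ω : V → CCovector V}

theorem isType20_symplecticInverse (h : IsQuaternionTriple g I J K) (v : V) :
    IsType20 I (symplecticInverse g I J v) :=
  isType20_component20 h.sqI fun α => by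
    simp only [LinearMap.smul_apply, wedge_apply]; rw [mul_comm, sub_self, smul_zero]

theorem symplecticInverse_apply
    (hα : ∀ X, α (I X) = Complex.I * α X) (hβ : ∀ X, β (I X) = Complex.I * β X) :
    symplecticInverse g I J v α β = ((g v v)⁻¹ : ℂ) * (α v * β (J v) - α (J v) * β v) := by
  rw [symplecticInverse, component20_apply, proj10_of_type10 hα, proj10_of_type10 hβ]
  simp [wedge_apply]

/-- Expansion of a covector of type `(1,0)`. -/
theorem type10_apply (h : IsQuaternionTriple g I J K) (hd : Module.finrank ℝ V = 4) (hv : v ≠ 0)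
    (hα : ∀ X, α (I X) = Complex.I * α X) (X : V) :
    α X = ((g v v)⁻¹ : ℂ) * (α v * (g v X + g (I v) X * Complex.I) +
      α (J v) * (g (J v) X + g (K v) X * Complex.I)) := by
  conv_lhs => rw [h.expand hd hv X]
  simp only [map_smul, map_add, hα, ← h.mulIJ, Complex.real_smul, Complex.ofReal_inv]
  ring

theorem type10_symplectic (h : IsQuaternionTriple g I J K)
    (hΩ : ∀ X Y, Ω X Y = g (J X) Y + g (K X) Y * Complex.I) (X Y : V) :
    Ω X (I Y) = Complex.I * Ω X Y := by
  rw [hΩ, hΩ, ← neg_neg (g (J X) (I Y)), ← neg_neg (g (K X) (I Y)), ← h.skewI, ← h.skewI,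
    h.mulIJ, h.mulIK]
  simp only [map_neg, neg_apply, Complex.ofReal_neg]
  linear_combination (- (g (K X) Y : ℂ)) * Complex.I_mul_I

theorem symplectic_frame (h : IsQuaternionTriple g I J K)
    (hΩ : ∀ X Y, Ω X Y = g (J X) Y + g (K X) Y * Complex.I) (X : V) :
    Ω X v = -(g (J v) X + g (K v) X * Complex.I) ∧ Ω X (J v) = g v X + g (I v) X * Complex.I := by
  rw [hΩ, hΩ, h.skewJ X, h.skewK X, h.hermJ, h.skewK X, h.mulKJ, h.symm X v, h.symm X (J v),
    h.symm X (K v), map_neg, neg_neg, h.symm X (I v)]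
  exact ⟨by push_cast; ring, rfl⟩

theorem symplectic_apply (h : IsQuaternionTriple g I J K) (hd : Module.finrank ℝ V = 4)
    (hv : v ≠ 0) (hΩ : ∀ X Y, Ω X Y = g (J X) Y + g (K X) Y * Complex.I) (X Y : V) :
    Ω X Y = ((g v v)⁻¹ : ℂ) *
      ((g v X + g (I v) X * Complex.I) * (g (J v) Y + g (K v) Y * Complex.I) -
       (g (J v) X + g (K v) X * Complex.I) * (g v Y + g (I v) Y * Complex.I)) := by
  rw [type10_apply h hd hv (type10_symplectic h hΩ X) Y, (symplectic_frame h hΩ X).1,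
    (symplectic_frame h hΩ X).2]
  ring

/-- `α ∧ β = Ω⁻¹(α, β) Ω` for covectors of type `(1,0)`. -/
theorem wedge_eq_symplecticInverse_mul (h : IsQuaternionTriple g I J K)
    (hd : Module.finrank ℝ V = 4) (hv : v ≠ 0)
    (hΩ : ∀ X Y, Ω X Y = g (J X) Y + g (K X) Y * Complex.I)
    (hα : ∀ X, α (I X) = Complex.I * α X) (hβ : ∀ X, β (I X) = Complex.I * β X) (X Y : V) :
    α X * β Y - α Y * β X = symplecticInverse g I J v α β * Ω X Y := by
  rw [symplecticInverse_apply hα hβ, symplectic_apply h hd hv hΩ, type10_apply h hd hv hα X,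
    type10_apply h hd hv hα Y, type10_apply h hd hv hβ X, type10_apply h hd hv hβ Y]
  ring

/-- Three covectors in the two-dimensional space of type (1,0) are dependent; this is Cramer's
relation, with `Ω⁻¹` as determinant. -/
theorem symplecticInverse_cyclic (h : IsQuaternionTriple g I J K)
    (hd : Module.finrank ℝ V = 4) (hv : v ≠ 0) {γ : CCovector V}
    (hα : ∀ X, α (I X) = Complex.I * α X) (hβ : ∀ X, β (I X) = Complex.I * β X)
    (hγ : ∀ X, γ (I X) = Complex.I * γ X) (X : V) :
    symplecticInverse g I J v β γ * α X + symplecticInverse g I J v γ α * β X +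
      symplecticInverse g I J v α β * γ X = 0 := by
  rw [symplecticInverse_apply hα hβ, symplecticInverse_apply hβ hγ, symplecticInverse_apply hγ hα,
    type10_apply h hd hv hα X, type10_apply h hd hv hβ X, type10_apply h hd hv hγ X]
  ring

theorem isInverse20_symplecticInverse (h : IsQuaternionTriple g I J K)
    (hd : Module.finrank ℝ V = 4) (hv : v ≠ 0)
    (hΩ : ∀ X Y, Ω X Y = g (J X) Y + g (K X) Y * Complex.I) :
    IsInverse20 I Ω (symplecticInverse g I J v) := by
  refine ⟨isType20_symplecticInverse h v, fun X Y => ?_⟩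
  rw [symplecticInverse_apply (type10_symplectic h hΩ X) (type10_symplectic h hΩ Y),
    symplectic_apply h hd hv hΩ X Y, (symplectic_frame (v := v) h hΩ X).1,
    (symplectic_frame h hΩ X).2, (symplectic_frame (v := v) h hΩ Y).1, (symplectic_frame h hΩ Y).2]
  ring

theorem exists_symplectic_ne_zero (h : IsQuaternionTriple g I J K) (hv : v ≠ 0)
    (hΩ : ∀ X Y, Ω X Y = g (J X) Y + g (K X) Y * Complex.I) : Ω v (J v) ≠ 0 := by
  rw [(symplectic_frame h hΩ v).2, h.symm (I v), h.apply_I_self]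
  simpa using (h.pos v hv).ne'

/-- If `θ ∧ Ω = 0`, then `θ` has type `(1,0)`. -/
theorem type10_of_wedge_eq_zero (h : IsQuaternionTriple g I J K) (hv : v ≠ 0)
    (hΩ : ∀ X Y, Ω X Y = g (J X) Y + g (K X) Y * Complex.I)
    {θ : CCovector V} (hθ : ∀ X Y Z, θ X * Ω Y Z + θ Y * Ω Z X + θ Z * Ω X Y = 0) (X : V) :
    θ (I X) = Complex.I * θ X := by
  have hne := exists_symplectic_ne_zero h hv hΩ
  have hskew : ∀ Y Z, Ω Y Z = -Ω Z Y := by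
    intro Y Z
    rw [hΩ, hΩ, h.skewJ, h.skewK, h.symm Y, h.symm Y]; push_cast; ring
  have hl : ∀ Y Z, Ω (I Y) Z = Complex.I * Ω Y Z := by
    intro Y Z
    rw [hskew, type10_symplectic h hΩ, hskew Z Y]; ring
  -- Since `Ω(v, J v) ≠ 0`, this expresses `θ X` through `Ω(J v, X)` and `Ω(X, v)`, both of type
  -- (1,0) in `X`.
  have h1 := hθ X v (J v)
  have h2 := hθ (I X) v (J v)
  rw [type10_symplectic h hΩ, hl] at h2
  refine mul_right_cancel₀ hne ?_
  linear_combination h2 - Complex.I * h1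

end Symplectic

section Orthonormal

variable [IsTopologicalAddGroup V] [ContinuousSMul ℝ V] {g : V →L[ℝ] V →L[ℝ] ℝ}
  {J : Fin 3 → V →L[ℝ] V} {b c : Fin 3 → ℝ}

/-- The product of two imaginary quaternions is minus the scalar product plus the cross product. -/
theorem sum_smul_sum_smul (hJ : IsQuaternionTriple g (J 0) (J 1) (J 2)) (b c : Fin 3 → ℝ) (v : V) :
    (∑ i, b i • J i) ((∑ i, c i • J i) v) = -((b ⬝ᵥ c) • v) + (∑ i, (b ⨯₃ c) i • J i) v := by
  simp only [Fin.sum_univ_three, add_apply, smul_apply,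
    map_add, map_smul, hJ.sqI, hJ.sqJ, hJ.sqK, hJ.mulIJ, hJ.mulJI, hJ.mulIK, hJ.mulKI, hJ.mulJK,
    hJ.mulKJ, dotProduct, Fin.sum_univ_three, cross_apply, Matrix.cons_val]
  module

theorem crossProduct_orthonormal (hb : b ⬝ᵥ b = 1) (hc : c ⬝ᵥ c = 1) (hbc : b ⬝ᵥ c = 0) :
    (b ⨯₃ c) ⬝ᵥ (b ⨯₃ c) = 1 ∧ (b ⨯₃ c) ⨯₃ b = c ∧ b ⨯₃ (b ⨯₃ c) = -c ∧ (b ⨯₃ c) ⨯₃ c = -b := by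
  refine ⟨by rw [cross_dot_cross, hb, hc, hbc, dotProduct_comm c b, hbc]; ring, ?_, ?_, ?_⟩ <;>
    simp only [dotProduct, Fin.sum_univ_three] at hb hc hbc <;> ext i
  · have e : ((b ⨯₃ c) ⨯₃ b) i = c i * (b 0 * b 0 + b 1 * b 1 + b 2 * b 2) -
        b i * (b 0 * c 0 + b 1 * c 1 + b 2 * c 2) := by
      fin_cases i <;> simp [cross_apply] <;> ring
    rw [e, hb, hbc]; ring
  · have e : (b ⨯₃ (b ⨯₃ c)) i = b i * (b 0 * c 0 + b 1 * c 1 + b 2 * c 2) -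
        c i * (b 0 * b 0 + b 1 * b 1 + b 2 * b 2) := by
      fin_cases i <;> simp [cross_apply] <;> ring
    rw [e, hb, hbc, Pi.neg_apply]; ring
  · have e : ((b ⨯₃ c) ⨯₃ c) i = c i * (b 0 * c 0 + b 1 * c 1 + b 2 * c 2) -
        b i * (c 0 * c 0 + c 1 * c 1 + c 2 * c 2) := by
      fin_cases i <;> simp [cross_apply] <;> ring
    rw [e, hc, hbc, Pi.neg_apply]; ring

/-- An oriented orthonormal basis of the imaginary quaternions satisfies the same relations as `i,
j, k`; this reduces an arbitrary `ζ` to the first member of a triple. -/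
theorem isQuaternionTriple_of_orthonormal (hJ : IsQuaternionTriple g (J 0) (J 1) (J 2))
    (hb : b ⬝ᵥ b = 1) (hc : c ⬝ᵥ c = 1) (hbc : b ⬝ᵥ c = 0) :
    IsQuaternionTriple g (∑ i, (b ⨯₃ c) i • J i) (∑ i, b i • J i) (∑ i, c i • J i) := by
  obtain ⟨hz, h1, h2, -⟩ := crossProduct_orthonormal hb hc hbc
  have skew : ∀ (d : Fin 3 → ℝ) v w, g ((∑ i, d i • J i) v) w = -g v ((∑ i, d i • J i) w) := by
    intro d v w
    simp only [Fin.sum_univ_three, add_apply, smul_apply,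
      map_add, map_smul, smul_eq_mul, hJ.skewI, hJ.skewJ, hJ.skewK]
    ring
  have sq : ∀ d : Fin 3 → ℝ, d ⬝ᵥ d = 1 → ∀ v, (∑ i, d i • J i) ((∑ i, d i • J i) v) = -v := by
    intro d hd v
    rw [sum_smul_sum_smul hJ, hd, cross_self]
    simp
  have herm : ∀ d : Fin 3 → ℝ, d ⬝ᵥ d = 1 → ∀ v w,
      g ((∑ i, d i • J i) v) ((∑ i, d i • J i) w) = g v w := by
    intro d hd v w
    rw [skew, sq d hd, map_neg, neg_neg]
  refine ⟨hJ.symm, hJ.pos, sq _ hz, sq _ hb, fun v => ?_, fun v => ?_, herm _ hz, herm _ hb⟩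
  · rw [sum_smul_sum_smul hJ, dotProduct_comm, dot_self_cross, h1]; simp
  · rw [sum_smul_sum_smul hJ, dot_self_cross, h2]
    simp [Finset.sum_neg_distrib]

/-- A square matrix with orthonormal rows has orthonormal columns. -/
theorem orthonormal_completeness (hb : b ⬝ᵥ b = 1) (hc : c ⬝ᵥ c = 1) (hbc : b ⬝ᵥ c = 0)
    (i j : Fin 3) :
    (b ⨯₃ c) i * (b ⨯₃ c) j + b i * b j + c i * c j = if i = j then 1 else 0 := by
  obtain ⟨hz, -⟩ := crossProduct_orthonormal hb hc hbc
  let A : Matrix (Fin 3) (Fin 3) ℝ := Matrix.of ![b ⨯₃ c, b, c]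
  have hA : A * Aᵀ = 1 := by
    ext p q
    change (![b ⨯₃ c, b, c] p) ⬝ᵥ (![b ⨯₃ c, b, c] q) = (1 : Matrix (Fin 3) (Fin 3) ℝ) p q
    fin_cases p <;> fin_cases q <;> simp [hz, hb, hc, hbc, dotProduct_comm (b ⨯₃ c) _,
      dotProduct_comm c b]
  have h2 := congrFun (congrFun ((mul_eq_one_comm (M := Matrix (Fin 3) (Fin 3) ℝ)).mp hA) i) j
  simpa [Matrix.mul_apply, Fin.sum_univ_three, A, Matrix.one_apply] using h2

theorem apply_eq_of_orthonormal (hb : b ⬝ᵥ b = 1) (hc : c ⬝ᵥ c = 1) (hbc : b ⬝ᵥ c = 0)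
    (a : Fin 3) (v : V) :
    J a v = (b ⨯₃ c) a • (∑ i, (b ⨯₃ c) i • J i) v + b a • (∑ i, b i • J i) v +
      c a • (∑ i, c i • J i) v := by
  have h : ∀ j, ((b ⨯₃ c) a * (b ⨯₃ c) j + b a * b j + c a * c j) • J j v =
      if a = j then J j v else 0 := by
    intro j
    rw [orthonormal_completeness hb hc hbc]; simp
  have hs := Finset.sum_congr (s₁ := Finset.univ) rfl fun j _ => h j
  rw [Finset.sum_ite_eq, if_pos (Finset.mem_univ _)] at hs
  rw [← hs]
  simp only [sum_apply, smul_apply, Finset.smul_sum, smul_smul, add_smul,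
    Finset.sum_add_distrib]

variable [T2Space V] [FiniteDimensional ℝ V]
  {P : (V →L[ℝ] ℝ) →ₗ[ℝ] (V →L[ℝ] ℝ) →ₗ[ℝ] ℝ} {f : Fin 3 → ℝ} {v : V} {α β : CCovector V}

/-- On covectors of type `(1,0)`, the bivector `∑ f_a ω_a⁻¹` is a multiple of `Ω⁻¹`. -/
theorem complexify_eq_mul_symplecticInverse (hJ : IsQuaternionTriple g (J 0) (J 1) (J 2))
    (hd : Module.finrank ℝ V = 4)
    (hP : ∀ α β, P α β = ∑ a, f a * inverseBivector (g.comp (J a)) α β) (hv : v ≠ 0)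
    (hb : b ⬝ᵥ b = 1) (hc : c ⬝ᵥ c = 1) (hbc : b ⬝ᵥ c = 0)
    (hα : ∀ X, α ((∑ i, (b ⨯₃ c) i • J i) X) = Complex.I * α X)
    (hβ : ∀ X, β ((∑ i, (b ⨯₃ c) i • J i) X) = Complex.I * β X) :
    complexify P α β = 2 * (∑ a, (f a : ℂ) * (b a + c a * Complex.I)) *
      symplecticInverse g (∑ i, (b ⨯₃ c) i • J i) (∑ i, b i • J i) v α β := by
  have hT := isQuaternionTriple_of_orthonormal hJ hb hc hbc
  obtain ⟨-, h1, -, h3⟩ := crossProduct_orthonormal hb hc hbc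
  rw [complexify_frame hJ hd hP hv, symplecticInverse_apply hα hβ]
  -- Expand `J a` in the rotated triple `I, J, K`; on type (1,0), `K v = I (J v)` and `I v`
  -- contribute only factors `i`.
  have key : ∀ (γ : CCovector V), (∀ X, γ ((∑ i, (b ⨯₃ c) i • J i) X) = Complex.I * γ X) →
      ∀ a, γ (J a v) = Complex.I * (b ⨯₃ c) a * γ v +
        (b a + c a * Complex.I) * γ ((∑ i, b i • J i) v) := by
    intro γ hγ a
    rw [apply_eq_of_orthonormal (J := J) hb hc hbc a v]
    simp only [map_add, map_smul, hγ, ← hT.mulIJ, Complex.real_smul]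
    ring
  simp only [key α hα, key β hβ]
  generalize (∑ i, b i • J i) v = w
  simp only [Fin.sum_univ_three]
  -- The remaining cross terms are the components of `ζ × (b + i c)`, which equals `-i (b + i c)`.
  -- They double the direct terms, whence the factor 2.
  have e : ∀ i, (((b ⨯₃ c) ⨯₃ b) i : ℂ) = c i ∧ (((b ⨯₃ c) ⨯₃ c) i : ℂ) = - b i := by
    intro i; rw [h1, h3]; simp
  generalize b ⨯₃ c = z at e
  have e0 := e 0
  have e1 := e 1
  have e2 := e 2
  simp only [cross_apply, Matrix.cons_val] at e0 e1 e2
  push_cast at e0 e1 e2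
  linear_combination ((g v v)⁻¹ : ℂ) * Complex.I * (α v * β w - α w * β v) *
    (f 0 * (e0.1 + Complex.I * e0.2) + f 1 * (e1.1 + Complex.I * e1.2) +
      f 2 * (e2.1 + Complex.I * e2.2)) -
    ((g v v)⁻¹ : ℂ) * (α v * β w - α w * β v) * (f 0 * b 0 + f 1 * b 1 + f 2 * b 2) *
      Complex.I_mul_I

end Orthonormal

end Pointwise

/-! ### Coordinate vector fields and second derivatives in a chart. -/

section ChartFrame

open VectorField Filter
open scoped Topology

variable {n : ℕ} {M : Type*} [TopologicalSpace M] [ChartedSpace (EuclideanSpace ℝ (Fin n)) M]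
  [IsManifold (𝓡 n) ∞ M]

/-- The coordinate vector field in the direction `e`, for the preferred chart at `x₀`. -/
noncomputable def chartField (x₀ : M) (e : EuclideanSpace ℝ (Fin n)) (y : M) :
    TangentSpace (𝓡 n) y :=
  (trivializationAt (EuclideanSpace ℝ (Fin n)) (TangentSpace (𝓡 n)) x₀).symmL ℝ y e

theorem smoothFieldAt_chartField (x₀ : M) (e : EuclideanSpace ℝ (Fin n)) {y : M}
    (hy : y ∈ (extChartAt (𝓡 n) x₀).source) : SmoothFieldAt (chartField x₀ e) y := by
  rw [extChartAt_source] at hy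
  have h := (trivializationAt (EuclideanSpace ℝ (Fin n)) (TangentSpace (𝓡 n)) x₀).contMDiffAt_symmL
    (IB := 𝓡 n) (n := ∞) (x := y) (by simpa using hy)
  have hc : ContMDiffAt (𝓡 n) ((𝓡 n).prod 𝓘(ℝ, EuclideanSpace ℝ (Fin n))) ∞
      (fun m : M => TotalSpace.mk' (EuclideanSpace ℝ (Fin n))
        (E := Bundle.Trivial M (EuclideanSpace ℝ (Fin n))) m e) y :=
    (Bundle.contMDiffAt_section _).mpr contMDiffAt_const
  exact h.clm_bundle_apply hc

theorem mfderivWithin_symm_eq_chartField {x₀ y : M} (hy : y ∈ (extChartAt (𝓡 n) x₀).source)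
    (e : EuclideanSpace ℝ (Fin n)) :
    chartField x₀ e y =
      mfderivWithin 𝓘(ℝ, EuclideanSpace ℝ (Fin n)) (𝓡 n) (extChartAt (𝓡 n) x₀).symm
        (Set.range (𝓡 n)) (extChartAt (𝓡 n) x₀ y) e := by
  rw [extChartAt_source] at hy
  rw [chartField, TangentBundle.symmL_trivializationAt hy]
  rfl

theorem exists_chartField_eq (x₀ : M) (X : TangentSpace (𝓡 n) x₀) :
    ∃ e, chartField x₀ e x₀ = X := by
  have h : ∀ e : EuclideanSpace ℝ (Fin n), chartField x₀ e x₀ = e := by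
    intro e
    rw [mfderivWithin_symm_eq_chartField (mem_extChartAt_source x₀),
      mfderivWithin_range_extChartAt_symm]
    rfl
  exact ⟨X, h X⟩

/-- In the chart both fields are constant near the image of `x₀`. -/
theorem mlieBracket_chartField (x₀ : M) (e e' : EuclideanSpace ℝ (Fin n)) :
    mlieBracket (𝓡 n) (chartField x₀ e) (chartField x₀ e') x₀ = 0 := by
  have key : ∀ e : EuclideanSpace ℝ (Fin n),
      (mpullbackWithin 𝓘(ℝ, EuclideanSpace ℝ (Fin n)) (𝓡 n) (extChartAt (𝓡 n) x₀).symm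
        (chartField x₀ e) (Set.range (𝓡 n))) =ᶠ[𝓝 (extChartAt (𝓡 n) x₀ x₀)] fun _ => e := by
    intro e
    filter_upwards [extChartAt_target_mem_nhds (I := 𝓡 n) x₀] with p hp
    rw [mpullbackWithin_apply, mfderivWithin_symm_eq_chartField
      ((extChartAt (𝓡 n) x₀).map_target hp), (extChartAt (𝓡 n) x₀).right_inv hp]
    exact (isInvertible_mfderivWithin_extChartAt_symm hp).inverse_apply_self e
  rw [← mlieBracketWithin_univ, mlieBracketWithin_apply,
    (key e).lieBracketWithin_vectorField_eq_nhds (key e')]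
  simp only [lieBracketWithin, fderivWithin_fun_const, Pi.zero_apply, zero_apply, sub_self]
  exact map_zero _

theorem mfderiv_chartField {F : Type*} [NormedAddCommGroup F] [NormedSpace ℝ F] {u : M → F}
    {x₀ y : M} (hy : y ∈ (extChartAt (𝓡 n) x₀).source)
    (hu : MDifferentiableAt (𝓡 n) 𝓘(ℝ, F) u y) (e : EuclideanSpace ℝ (Fin n)) :
    mfderiv (𝓡 n) 𝓘(ℝ, F) u y (chartField x₀ e y) =
      fderiv ℝ (u ∘ (extChartAt (𝓡 n) x₀).symm) (extChartAt (𝓡 n) x₀ y) e := by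
  have hy' := (extChartAt (𝓡 n) x₀).map_source hy
  have hs := mdifferentiableWithinAt_extChartAt_symm (I := 𝓡 n) hy'
  rw [mfderivWithin_symm_eq_chartField hy]
  simp only [modelWithCornersSelf_coe, Set.range_id, mdifferentiableWithinAt_univ,
    mfderivWithin_univ] at hs ⊢
  rw [← mfderiv_eq_fderiv, mfderiv_comp_of_eq hu hs ((extChartAt (𝓡 n) x₀).left_inv hy)]
  -- The chain rule gives the derivative at the image of `y` under chart and inverse chart. Viewing
  -- tangent spaces as the model space allows this point to be replaced by `y`.
  have key : ∀ z : M, z = y → ∀ w : EuclideanSpace ℝ (Fin n),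
      (mfderiv (𝓡 n) 𝓘(ℝ, F) u y : EuclideanSpace ℝ (Fin n) →L[ℝ] F) w =
        (mfderiv (𝓡 n) 𝓘(ℝ, F) u z : EuclideanSpace ℝ (Fin n) →L[ℝ] F) w := by
    rintro _ rfl _; rfl
  exact key _ ((extChartAt (𝓡 n) x₀).left_inv hy) _

theorem contDiffAt_comp_symm {F : Type*} [NormedAddCommGroup F] [NormedSpace ℝ F] {u : M → F}
    {x₀ y : M} (hy : y ∈ (extChartAt (𝓡 n) x₀).source)
    (hu : ContMDiffAt (𝓡 n) 𝓘(ℝ, F) ∞ u y) :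
    ContDiffAt ℝ ∞ (u ∘ (extChartAt (𝓡 n) x₀).symm) (extChartAt (𝓡 n) x₀ y) := by
  have hy' := (extChartAt (𝓡 n) x₀).map_source hy
  rw [← contMDiffAt_iff_contDiffAt]
  have hs := (contMDiffOn_extChartAt_symm (I := 𝓡 n) (n := ∞) x₀).contMDiffAt
    ((isOpen_extChartAt_target x₀).mem_nhds hy')
  exact ContMDiffAt.comp_of_eq hu hs ((extChartAt (𝓡 n) x₀).left_inv hy)

variable {U : Set M} {u : M → ℂ} {x₀ : M}

theorem cdiff_chartField_eventuallyEq (hU : IsOpen U) (hu : ContMDiffOn (𝓡 n) 𝓘(ℝ, ℂ) ∞ u U)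
    (hx : x₀ ∈ U) (e : EuclideanSpace ℝ (Fin n)) :
    (fun y => cdiff (n := n) u y (chartField x₀ e y)) =ᶠ[𝓝 x₀]
      (fun y => fderiv ℝ (u ∘ (extChartAt (𝓡 n) x₀).symm) (extChartAt (𝓡 n) x₀ y) e) := by
  filter_upwards [hU.mem_nhds hx, extChartAt_source_mem_nhds (I := 𝓡 n) x₀] with y hyU hy
  exact mfderiv_chartField hy
    ((hu.contMDiffAt (hU.mem_nhds hyU)).mdifferentiableAt (by simp)) e

theorem contMDiffAt_cdiff_chartField (hU : IsOpen U) (hu : ContMDiffOn (𝓡 n) 𝓘(ℝ, ℂ) ∞ u U)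
    (hx : x₀ ∈ U) (e : EuclideanSpace ℝ (Fin n)) :
    ContMDiffAt (𝓡 n) 𝓘(ℝ, ℂ) ∞ (fun y => cdiff (n := n) u y (chartField x₀ e y)) x₀ := by
  refine ContMDiffAt.congr_of_eventuallyEq ?_ (cdiff_chartField_eventuallyEq hU hu hx e)
  have h := contDiffAt_comp_symm (mem_extChartAt_source x₀) (hu.contMDiffAt (hU.mem_nhds hx))
  have h' : ContDiffAt ℝ ∞ (fun p => fderiv ℝ (u ∘ (extChartAt (𝓡 n) x₀).symm) p e)
      (extChartAt (𝓡 n) x₀ x₀) :=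
    (h.fderiv_right (m := ∞) (by simp)).clm_apply contDiffAt_const
  exact h'.contMDiffAt.comp x₀ contMDiffAt_extChartAt

/-- Coordinate vector fields commute. -/
theorem cdiff_cdiff_chartField_comm (hU : IsOpen U) (hu : ContMDiffOn (𝓡 n) 𝓘(ℝ, ℂ) ∞ u U)
    (hx : x₀ ∈ U) (e e' : EuclideanSpace ℝ (Fin n)) :
    cdiff (n := n) (fun y => cdiff (n := n) u y (chartField x₀ e y)) x₀ (chartField x₀ e' x₀) =
      cdiff (n := n) (fun y => cdiff (n := n) u y (chartField x₀ e' y)) x₀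
        (chartField x₀ e x₀) := by
  have h := contDiffAt_comp_symm (mem_extChartAt_source x₀) (hu.contMDiffAt (hU.mem_nhds hx))
  have h' := ((h.fderiv_right (m := ∞) (by simp)).differentiableAt (by simp))
  have key : ∀ e e' : EuclideanSpace ℝ (Fin n),
      cdiff (n := n) (fun y => cdiff (n := n) u y (chartField x₀ e y)) x₀ (chartField x₀ e' x₀) =
      fderiv ℝ (fderiv ℝ (u ∘ (extChartAt (𝓡 n) x₀).symm)) (extChartAt (𝓡 n) x₀ x₀) e' e := by
    intro e e'
    refine (mfderiv_chartField (mem_extChartAt_source x₀)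
      ((contMDiffAt_cdiff_chartField hU hu hx e).mdifferentiableAt (by simp)) e').trans ?_
    have hev : (fun y => cdiff (n := n) u y (chartField x₀ e y)) ∘ (extChartAt (𝓡 n) x₀).symm
        =ᶠ[𝓝 (extChartAt (𝓡 n) x₀ x₀)]
        fun p => fderiv ℝ (u ∘ (extChartAt (𝓡 n) x₀).symm) p e := by
      have ht := (continuousAt_extChartAt_symm (I := 𝓡 n) x₀).tendsto
      rw [extChartAt_to_inv] at ht
      filter_upwards [ht.eventually (cdiff_chartField_eventuallyEq hU hu hx e),
        extChartAt_target_mem_nhds (I := 𝓡 n) x₀] with p hp hp'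
      rw [Function.comp_apply, hp, (extChartAt (𝓡 n) x₀).right_inv hp']
    rw [hev.fderiv_eq, fderiv_clm_apply h' (differentiableAt_const e)]
    simp only [fderiv_fun_const, Pi.zero_apply, ContinuousLinearMap.comp_zero, zero_add,
      ContinuousLinearMap.flip_apply]
    rfl
  rw [key, key]
  exact (h.isSymmSndFDerivAt (by
    simpa using WithTop.coe_le_coe.2 (le_top : (2 : ℕ∞) ≤ ⊤))).eq _ _

end ChartFrame

/-! ### Differential calculus of complex-valued functions. -/

section ComplexFunctions

open Filter
open scoped Topology

variable {n : ℕ} {M : Type*} [TopologicalSpace M] [ChartedSpace (EuclideanSpace ℝ (Fin n)) M]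
  {f g : M → ℂ} {x : M}

theorem cdiff_add_apply (hf : MDifferentiableAt (𝓡 n) 𝓘(ℝ, ℂ) f x)
    (hg : MDifferentiableAt (𝓡 n) 𝓘(ℝ, ℂ) g x) (X : TangentSpace (𝓡 n) x) :
    cdiff (n := n) (fun y => f y + g y) x X = cdiff (n := n) f x X + cdiff (n := n) g x X := by
  have h := (hf.hasMFDerivAt.add hg.hasMFDerivAt).mfderiv
  exact congrArg (fun A : TangentSpace (𝓡 n) x →L[ℝ] ℂ => A X) h

theorem cdiff_sub_apply (hf : MDifferentiableAt (𝓡 n) 𝓘(ℝ, ℂ) f x)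
    (hg : MDifferentiableAt (𝓡 n) 𝓘(ℝ, ℂ) g x) (X : TangentSpace (𝓡 n) x) :
    cdiff (n := n) (fun y => f y - g y) x X = cdiff (n := n) f x X - cdiff (n := n) g x X := by
  have h := (hf.hasMFDerivAt.sub hg.hasMFDerivAt).mfderiv
  exact congrArg (fun A : TangentSpace (𝓡 n) x →L[ℝ] ℂ => A X) h

theorem cdiff_mul_apply (hf : MDifferentiableAt (𝓡 n) 𝓘(ℝ, ℂ) f x)
    (hg : MDifferentiableAt (𝓡 n) 𝓘(ℝ, ℂ) g x) (X : TangentSpace (𝓡 n) x) :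
    cdiff (n := n) (fun y => f y * g y) x X =
      f x * cdiff (n := n) g x X + g x * cdiff (n := n) f x X := by
  have h := (hf.hasMFDerivAt.mul hg.hasMFDerivAt).mfderiv
  exact congrArg (fun A : TangentSpace (𝓡 n) x →L[ℝ] ℂ => A X) h

theorem cdiff_const_apply (c : ℂ) (X : TangentSpace (𝓡 n) x) :
    cdiff (n := n) (fun _ : M => c) x X = 0 := by
  have h : mfderiv (𝓡 n) 𝓘(ℝ, ℂ) (fun _ : M => c) x = 0 := mfderiv_const
  exact congrArg (fun A : TangentSpace (𝓡 n) x →L[ℝ] ℂ => A X) h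

theorem cdiff_const_mul_apply (c : ℂ) (hf : MDifferentiableAt (𝓡 n) 𝓘(ℝ, ℂ) f x)
    (X : TangentSpace (𝓡 n) x) :
    cdiff (n := n) (fun y => c * f y) x X = c * cdiff (n := n) f x X := by
  rw [cdiff_mul_apply mdifferentiableAt_const hf, cdiff_const_apply, mul_zero, add_zero]

theorem mdifferentiableAt_ofReal {f : M → ℝ} (hf : MDifferentiableAt (𝓡 n) 𝓘(ℝ, ℝ) f x) :
    MDifferentiableAt (𝓡 n) 𝓘(ℝ, ℂ) (fun y => (f y : ℂ)) x :=
  (Complex.ofRealCLM.differentiableAt.mdifferentiableAt).comp x hf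

theorem contMDiffAt_ofReal {f : M → ℝ} (hf : ContMDiffAt (𝓡 n) 𝓘(ℝ, ℝ) ∞ f x) :
    ContMDiffAt (𝓡 n) 𝓘(ℝ, ℂ) ∞ (fun y => (f y : ℂ)) x :=
  (Complex.ofRealCLM.contDiff.contMDiff.contMDiffAt).comp x hf

theorem cdiff_ofReal_apply {f : M → ℝ} (hf : MDifferentiableAt (𝓡 n) 𝓘(ℝ, ℝ) f x)
    (X : TangentSpace (𝓡 n) x) :
    cdiff (n := n) (fun y => (f y : ℂ)) x X = (rdiff (n := n) f x X : ℂ) := by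
  have h := (Complex.ofRealCLM.hasFDerivAt.hasMFDerivAt.comp x hf.hasMFDerivAt).mfderiv
  exact congrArg (fun A : TangentSpace (𝓡 n) x →L[ℝ] ℂ => A X) h

theorem cdiff_congr (h : f =ᶠ[𝓝 x] g) : cdiff (n := n) f x = cdiff (n := n) g x :=
  h.mfderiv_eq

theorem contMDiffAt_mul (hf : ContMDiffAt (𝓡 n) 𝓘(ℝ, ℂ) ∞ f x)
    (hg : ContMDiffAt (𝓡 n) 𝓘(ℝ, ℂ) ∞ g x) :
    ContMDiffAt (𝓡 n) 𝓘(ℝ, ℂ) ∞ (fun y => f y * g y) x :=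
  (contDiff_mul (𝕜 := ℝ) (𝔸 := ℂ)).contMDiff.contMDiffAt.comp x (hf.prodMk_space hg)

theorem contMDiffAt_inv (hf : ContMDiffAt (𝓡 n) 𝓘(ℝ, ℂ) ∞ f x) (h : f x ≠ 0) :
    ContMDiffAt (𝓡 n) 𝓘(ℝ, ℂ) ∞ (fun y => (f y)⁻¹) x :=
  (contDiffAt_inv ℝ h).contMDiffAt.comp x hf

end ComplexFunctions

/-! ### Exterior derivatives of two identities, computed with coordinate fields. -/

section Exterior

open Filter
open scoped Topology

variable {n : ℕ} {M : Type*} [TopologicalSpace M] [ChartedSpace (EuclideanSpace ℝ (Fin n)) M]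
  [IsManifold (𝓡 n) ∞ M] {U : Set M} {x : M}

/-- If `∑ sᵢ duᵢ = 0`, then `∑ dsᵢ ∧ duᵢ = 0`. -/
theorem sum_cdiff_wedge_eq_zero {s u : Fin 3 → M → ℂ} (hU : IsOpen U)
    (hs : ∀ i, ContMDiffOn (𝓡 n) 𝓘(ℝ, ℂ) ∞ (s i) U) (hu : ∀ i, ContMDiffOn (𝓡 n) 𝓘(ℝ, ℂ) ∞ (u i) U)
    (h : ∀ y ∈ U, ∀ X, ∑ i, s i y * cdiff (n := n) (u i) y X = 0) (hx : x ∈ U)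
    (X Y : TangentSpace (𝓡 n) x) :
    ∑ i, (cdiff (n := n) (s i) x X * cdiff (n := n) (u i) x Y -
      cdiff (n := n) (s i) x Y * cdiff (n := n) (u i) x X) = 0 := by
  have hsd : ∀ i, MDifferentiableAt (𝓡 n) 𝓘(ℝ, ℂ) (s i) x := fun i =>
    ((hs i).contMDiffAt (hU.mem_nhds hx)).mdifferentiableAt (by simp)
  have hud : ∀ i (e : EuclideanSpace ℝ (Fin n)), MDifferentiableAt (𝓡 n) 𝓘(ℝ, ℂ)
      (fun y => cdiff (n := n) (u i) y (chartField x e y)) x := fun i e =>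
    (contMDiffAt_cdiff_chartField hU (hu i) hx e).mdifferentiableAt (by simp)
  have hsu : ∀ i (e : EuclideanSpace ℝ (Fin n)), MDifferentiableAt (𝓡 n) 𝓘(ℝ, ℂ)
      (fun y => s i y * cdiff (n := n) (u i) y (chartField x e y)) x := fun i e =>
    (hsd i).mul (hud i e)
  have key : ∀ e e' : EuclideanSpace ℝ (Fin n),
      ∑ i, (s i x * cdiff (n := n) (fun y => cdiff (n := n) (u i) y (chartField x e y)) x
        (chartField x e' x) + cdiff (n := n) (u i) x (chartField x e x) *
        cdiff (n := n) (s i) x (chartField x e' x)) = 0 := by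
    intro e e'
    have h0 : (fun y => s 0 y * cdiff (n := n) (u 0) y (chartField x e y) +
        s 1 y * cdiff (n := n) (u 1) y (chartField x e y) +
        s 2 y * cdiff (n := n) (u 2) y (chartField x e y)) =ᶠ[𝓝 x] fun _ => 0 := by
      filter_upwards [hU.mem_nhds hx] with y hy
      rw [← h y hy (chartField x e y), Fin.sum_univ_three]
    have h1 := congrArg (fun A : CCovector (TangentSpace (𝓡 n) x) => A (chartField x e' x))
      (cdiff_congr h0)
    simp only [cdiff_const_apply] at h1
    rw [cdiff_add_apply (f := fun y => s 0 y * cdiff (n := n) (u 0) y (chartField x e y) +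
        s 1 y * cdiff (n := n) (u 1) y (chartField x e y)) ((hsu 0 e).add (hsu 1 e)) (hsu 2 e),
      cdiff_add_apply (hsu 0 e) (hsu 1 e), cdiff_mul_apply (hsd 0) (hud 0 e),
      cdiff_mul_apply (hsd 1) (hud 1 e), cdiff_mul_apply (hsd 2) (hud 2 e)] at h1
    rw [Fin.sum_univ_three, h1]
  obtain ⟨X, rfl⟩ := exists_chartField_eq x X
  obtain ⟨Y, rfl⟩ := exists_chartField_eq x Y
  have h1 := key X Y
  have h2 := key Y X
  rw [Fin.sum_univ_three] at h1 h2 ⊢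
  rw [cdiff_cdiff_chartField_comm hU (hu 0) hx, cdiff_cdiff_chartField_comm hU (hu 1) hx,
    cdiff_cdiff_chartField_comm hU (hu 2) hx] at h1
  -- Antisymmetrising cancels the second derivatives of the `uᵢ`.
  linear_combination h2 - h1

/-- If `du ∧ dv = F Ω` for a closed form `Ω` without zeros, then `F` is smooth and
`dF ∧ Ω = 0`. -/
theorem smooth_and_cdiff_wedge_eq_zero {u v F : M → ℂ}
    {Ω : ∀ y : M, TangentSpace (𝓡 n) y → CCovector (TangentSpace (𝓡 n) y)} (hU : IsOpen U)
    (hu : ContMDiffOn (𝓡 n) 𝓘(ℝ, ℂ) ∞ u U) (hv : ContMDiffOn (𝓡 n) 𝓘(ℝ, ℂ) ∞ v U)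
    (hΩ : ∀ (x : M) (e e' : EuclideanSpace ℝ (Fin n)), ContMDiffAt (𝓡 n) 𝓘(ℝ, ℂ) ∞
      (fun y => Ω y (chartField x e y) (chartField x e' y)) x)
    (hcl : ∀ (x : M) (a b c : EuclideanSpace ℝ (Fin n)),
      cdiff (n := n) (fun y => Ω y (chartField x b y) (chartField x c y)) x (chartField x a x) +
      cdiff (n := n) (fun y => Ω y (chartField x c y) (chartField x a y)) x (chartField x b x) +
      cdiff (n := n) (fun y => Ω y (chartField x a y) (chartField x b y)) x (chartField x c x) = 0)
    (hne : ∀ x, ∃ X Y, Ω x X Y ≠ 0)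
    (h : ∀ y ∈ U, ∀ X Y, cdiff (n := n) u y X * cdiff (n := n) v y Y -
      cdiff (n := n) u y Y * cdiff (n := n) v y X = F y * Ω y X Y) :
    ContMDiffOn (𝓡 n) 𝓘(ℝ, ℂ) ∞ F U ∧ ∀ x ∈ U, ∀ X Y Z,
      cdiff (n := n) F x X * Ω x Y Z + cdiff (n := n) F x Y * Ω x Z X +
        cdiff (n := n) F x Z * Ω x X Y = 0 := by
  have hsm : ∀ x ∈ U, ContMDiffAt (𝓡 n) 𝓘(ℝ, ℂ) ∞ F x := by
    intro x hx
    obtain ⟨X, Y, hne'⟩ := hne x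
    obtain ⟨X, rfl⟩ := exists_chartField_eq x X
    obtain ⟨Y, rfl⟩ := exists_chartField_eq x Y
    have hN : ∀ e e' : EuclideanSpace ℝ (Fin n), ContMDiffAt (𝓡 n) 𝓘(ℝ, ℂ) ∞
        (fun y => cdiff (n := n) u y (chartField x e y) * cdiff (n := n) v y (chartField x e' y))
        x := fun e e' => contMDiffAt_mul (contMDiffAt_cdiff_chartField hU hu hx e)
          (contMDiffAt_cdiff_chartField hU hv hx e')
    -- Near `x`, `F` is the quotient of `(du ∧ dv)(X, Y)` by the nonvanishing `Ω(X, Y)`.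
    refine (contMDiffAt_mul ((hN X Y).sub (hN Y X))
      (contMDiffAt_inv (hΩ x X Y) hne')).congr_of_eventuallyEq ?_
    filter_upwards [hU.mem_nhds hx, (hΩ x X Y).continuousAt.eventually_ne hne'] with y hy hy'
    have := h y hy (chartField x X y) (chartField x Y y)
    rw [eq_mul_inv_iff_mul_eq₀ hy', ← this]
  refine ⟨fun x hx => (hsm x hx).contMDiffWithinAt, fun x hx X Y Z => ?_⟩
  have hud : ∀ e : EuclideanSpace ℝ (Fin n), MDifferentiableAt (𝓡 n) 𝓘(ℝ, ℂ)
      (fun y => cdiff (n := n) u y (chartField x e y)) x := fun e =>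
    (contMDiffAt_cdiff_chartField hU hu hx e).mdifferentiableAt (by simp)
  have hvd : ∀ e : EuclideanSpace ℝ (Fin n), MDifferentiableAt (𝓡 n) 𝓘(ℝ, ℂ)
      (fun y => cdiff (n := n) v y (chartField x e y)) x := fun e =>
    (contMDiffAt_cdiff_chartField hU hv hx e).mdifferentiableAt (by simp)
  have key : ∀ a b c : EuclideanSpace ℝ (Fin n),
      cdiff (n := n) u x (chartField x b x) * cdiff (n := n)
          (fun y => cdiff (n := n) v y (chartField x c y)) x (chartField x a x) +
        cdiff (n := n) v x (chartField x c x) * cdiff (n := n)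
          (fun y => cdiff (n := n) u y (chartField x b y)) x (chartField x a x) -
        (cdiff (n := n) u x (chartField x c x) * cdiff (n := n)
          (fun y => cdiff (n := n) v y (chartField x b y)) x (chartField x a x) +
        cdiff (n := n) v x (chartField x b x) * cdiff (n := n)
          (fun y => cdiff (n := n) u y (chartField x c y)) x (chartField x a x)) =
      F x * cdiff (n := n) (fun y => Ω y (chartField x b y) (chartField x c y)) x
          (chartField x a x) +
        Ω x (chartField x b x) (chartField x c x) * cdiff (n := n) F x (chartField x a x) := by
    intro a b c
    have h0 : (fun y => cdiff (n := n) u y (chartField x b y) *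
        cdiff (n := n) v y (chartField x c y) - cdiff (n := n) u y (chartField x c y) *
        cdiff (n := n) v y (chartField x b y)) =ᶠ[𝓝 x]
        fun y => F y * Ω y (chartField x b y) (chartField x c y) := by
      filter_upwards [hU.mem_nhds hx] with y hy
      exact h y hy _ _
    have h1 := congrArg (fun A : CCovector (TangentSpace (𝓡 n) x) => A (chartField x a x))
      (cdiff_congr h0)
    beta_reduce at h1
    rw [cdiff_sub_apply
        (f := fun y => cdiff (n := n) u y (chartField x b y) * cdiff (n := n) v y (chartField x c y))
        (g := fun y => cdiff (n := n) u y (chartField x c y) * cdiff (n := n) v y (chartField x b y))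
        ((hud b).mul (hvd c)) ((hud c).mul (hvd b)),
      cdiff_mul_apply (hud b) (hvd c), cdiff_mul_apply (hud c) (hvd b),
      cdiff_mul_apply ((hsm x hx).mdifferentiableAt (by simp))
        ((hΩ x b c).mdifferentiableAt (by simp))] at h1
    exact h1
  obtain ⟨X, rfl⟩ := exists_chartField_eq x X
  obtain ⟨Y, rfl⟩ := exists_chartField_eq x Y
  obtain ⟨Z, rfl⟩ := exists_chartField_eq x Z
  have k1 := key X Y Z
  have k2 := key Y Z X
  have k3 := key Z X Y
  have hc := hcl x X Y Z
  -- In the cyclic sum the left sides give `d(du ∧ dv) = 0` by symmetry of second derivatives; the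
  -- right sides give `dF ∧ Ω + F dΩ`.
  rw [cdiff_cdiff_chartField_comm hU hu hx Z X, cdiff_cdiff_chartField_comm hU hv hx Z X] at k1
  rw [cdiff_cdiff_chartField_comm hU hu hx X Y, cdiff_cdiff_chartField_comm hU hv hx X Y] at k2
  rw [cdiff_cdiff_chartField_comm hU hu hx Y Z, cdiff_cdiff_chartField_comm hU hv hx Y Z] at k3
  linear_combination -k1 - k2 - k3 - F x * hc

end Exterior

/-! ### The hyperkähler triple at a point; smoothness and closedness of `Ω`. -/

section Structure

variable {n : ℕ} {M : Type*} [TopologicalSpace M] [ChartedSpace (EuclideanSpace ℝ (Fin n)) M]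

instance tangentSpace_t2Space (x : M) : T2Space (TangentSpace (𝓡 n) x) :=
  inferInstanceAs (T2Space (EuclideanSpace ℝ (Fin n)))

instance tangentSpace_finiteDimensional (x : M) : FiniteDimensional ℝ (TangentSpace (𝓡 n) x) :=
  inferInstanceAs (FiniteDimensional ℝ (EuclideanSpace ℝ (Fin n)))

theorem finrank_tangentSpace (x : M) : Module.finrank ℝ (TangentSpace (𝓡 n) x) = n :=
  finrank_euclideanSpace_fin (𝕜 := ℝ) (n := n)

variable [IsManifold (𝓡 n) ∞ M]

theorem HyperkahlerStructure.isQuaternionTriple (hk : HyperkahlerStructure n M) (x : M) :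
    IsQuaternionTriple (hk.metric.inner x) (hk.J 0 x) (hk.J 1 x) (hk.J 2 x) where
  symm := hk.metric.symm x
  pos := hk.metric.pos x
  sqI := hk.sq 0 x
  sqJ := hk.sq 1 x
  mulIJ := hk.mul x
  mulJI v := by
    -- Anticommutation is extracted from `K² = -1` with `K = I J`, evaluated at `J v`.
    have h := hk.sq 2 x (hk.J 1 x v)
    rw [← hk.mul, ← hk.mul, hk.sq 1, map_neg, map_neg, map_neg, neg_inj] at h
    rw [← hk.mul, ← h, hk.sq 0, neg_neg]
  hermI := hk.hermitian 0 x
  hermJ := hk.hermitian 1 x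

variable (hk : HyperkahlerStructure n M) {X Y : ∀ x : M, TangentSpace (𝓡 n) x} {x : M}

theorem HyperkahlerStructure.smoothFieldAt_J (a : Fin 3) (hX : SmoothFieldAt X x) :
    SmoothFieldAt (fun y => hk.J a y (X y)) x :=
  ((hk.smooth a).contMDiffAt (x := x)).clm_bundle_apply hX

theorem HyperkahlerStructure.contMDiffAt_inner (hX : SmoothFieldAt X x) (hY : SmoothFieldAt Y x) :
    ContMDiffAt (𝓡 n) 𝓘(ℝ, ℝ) ∞ (fun y => hk.metric.inner y (X y) (Y y)) x := by
  have h := (hk.metric.contMDiff.contMDiffAt (x := x)).clm_bundle_apply₂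
    (F₁ := EuclideanSpace ℝ (Fin n)) (F₂ := EuclideanSpace ℝ (Fin n)) (F₃ := ℝ)
    (E₃ := Bundle.Trivial M ℝ) hX hY
  exact (Bundle.contMDiffAt_section _).mp h

theorem HyperkahlerStructure.contMDiffAt_kahlerForm (a : Fin 3) (hX : SmoothFieldAt X x)
    (hY : SmoothFieldAt Y x) :
    ContMDiffAt (𝓡 n) 𝓘(ℝ, ℝ) ∞ (fun y => hk.kahlerForm a y (X y) (Y y)) x :=
  hk.contMDiffAt_inner (hk.smoothFieldAt_J a hX) hY

theorem HyperkahlerStructure.holSymplectic_apply (b c : Fin 3 → ℝ) (x : M)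
    (X Y : TangentSpace (𝓡 n) x) :
    hk.holSymplectic b c x X Y = ∑ i, ((b i : ℂ) + c i * Complex.I) * (hk.kahlerForm i x X Y : ℂ) := by
  simp [HyperkahlerStructure.holSymplectic, sum_apply]

theorem HyperkahlerStructure.holSymplectic_eq (b c : Fin 3 → ℝ) (x : M)
    (X Y : TangentSpace (𝓡 n) x) :
    hk.holSymplectic b c x X Y = hk.metric.inner x ((∑ i, b i • hk.J i x) X) Y +
      hk.metric.inner x ((∑ i, c i • hk.J i x) X) Y * Complex.I := by
  rw [hk.holSymplectic_apply]
  simp only [Fin.sum_univ_three, HyperkahlerStructure.kahlerForm, ContinuousLinearMap.comp_apply,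
    add_apply, smul_apply, map_add, map_smul, smul_eq_mul]
  push_cast
  ring

theorem HyperkahlerStructure.contMDiffAt_holSymplectic (b c : Fin 3 → ℝ)
    (hX : SmoothFieldAt X x) (hY : SmoothFieldAt Y x) :
    ContMDiffAt (𝓡 n) 𝓘(ℝ, ℂ) ∞ (fun y => hk.holSymplectic b c y (X y) (Y y)) x := by
  simp only [hk.holSymplectic_apply, Fin.sum_univ_three]
  have h : ∀ i, ContMDiffAt (𝓡 n) 𝓘(ℝ, ℂ) ∞ (fun y => ((b i : ℂ) + c i * Complex.I) *
      (hk.kahlerForm i y (X y) (Y y) : ℂ)) x := fun i =>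
    contMDiffAt_mul contMDiffAt_const (contMDiffAt_ofReal (hk.contMDiffAt_kahlerForm i hX hY))
  exact ((h 0).add (h 1)).add (h 2)

theorem HyperkahlerStructure.cdiff_holSymplectic_apply (b c : Fin 3 → ℝ)
    (hX : SmoothFieldAt X x) (hY : SmoothFieldAt Y x) (Z : TangentSpace (𝓡 n) x) :
    cdiff (n := n) (fun y => hk.holSymplectic b c y (X y) (Y y)) x Z =
      ∑ i, ((b i : ℂ) + c i * Complex.I) *
        (rdiff (n := n) (fun y => hk.kahlerForm i y (X y) (Y y)) x Z : ℂ) := by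
  have h : ∀ i, MDifferentiableAt (𝓡 n) 𝓘(ℝ, ℝ) (fun y => hk.kahlerForm i y (X y) (Y y)) x :=
    fun i => (hk.contMDiffAt_kahlerForm i hX hY).mdifferentiableAt (by simp)
  have h' : ∀ i, MDifferentiableAt (𝓡 n) 𝓘(ℝ, ℂ) (fun y => ((b i : ℂ) + c i * Complex.I) *
      (hk.kahlerForm i y (X y) (Y y) : ℂ)) x := fun i =>
    mdifferentiableAt_const.mul (mdifferentiableAt_ofReal (h i))
  simp only [hk.holSymplectic_apply, Fin.sum_univ_three]
  rw [cdiff_add_apply (f := fun y => ((b 0 : ℂ) + c 0 * Complex.I) *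
      (hk.kahlerForm 0 y (X y) (Y y) : ℂ) + ((b 1 : ℂ) + c 1 * Complex.I) *
      (hk.kahlerForm 1 y (X y) (Y y) : ℂ)) ((h' 0).add (h' 1)) (h' 2),
    cdiff_add_apply (h' 0) (h' 1)]
  simp only [cdiff_const_mul_apply _ (mdifferentiableAt_ofReal (h _)), cdiff_ofReal_apply (h _)]

/-- On coordinate fields the bracket terms of `dω_i` vanish at the centre of the chart; the identity
for `Ω` is the complex combination of those for the `ω_i`. -/
theorem HyperkahlerStructure.holSymplectic_closed (b c : Fin 3 → ℝ) (x : M)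
    (e₁ e₂ e₃ : EuclideanSpace ℝ (Fin n)) :
    cdiff (n := n) (fun y => hk.holSymplectic b c y (chartField x e₂ y) (chartField x e₃ y)) x
        (chartField x e₁ x) +
      cdiff (n := n) (fun y => hk.holSymplectic b c y (chartField x e₃ y) (chartField x e₁ y)) x
        (chartField x e₂ x) +
      cdiff (n := n) (fun y => hk.holSymplectic b c y (chartField x e₁ y) (chartField x e₂ y)) x
        (chartField x e₃ x) = 0 := by
  have hs : ∀ e : EuclideanSpace ℝ (Fin n), SmoothFieldAt (chartField x e) x := fun e =>
    smoothFieldAt_chartField x e (mem_extChartAt_source x)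
  have h : ∀ i, (rdiff (n := n) (fun y => hk.kahlerForm i y (chartField x e₂ y)
        (chartField x e₃ y)) x (chartField x e₁ x) : ℂ) +
      rdiff (n := n) (fun y => hk.kahlerForm i y (chartField x e₃ y)
        (chartField x e₁ y)) x (chartField x e₂ x) +
      rdiff (n := n) (fun y => hk.kahlerForm i y (chartField x e₁ y)
        (chartField x e₂ y)) x (chartField x e₃ x) = 0 := by
    intro i
    have hc := hk.closed i x _ _ _ (hs e₁) (hs e₂) (hs e₃)
    simp only [mlieBracket_chartField, map_zero, zero_apply, sub_zero] at hc
    exact_mod_cast hc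
  rw [hk.cdiff_holSymplectic_apply b c (hs _) (hs _), hk.cdiff_holSymplectic_apply b c (hs _) (hs _),
    hk.cdiff_holSymplectic_apply b c (hs _) (hs _)]
  simp only [Fin.sum_univ_three]
  linear_combination ((b 0 : ℂ) + c 0 * Complex.I) * h 0 + ((b 1 : ℂ) + c 1 * Complex.I) * h 1 +
    ((b 2 : ℂ) + c 2 * Complex.I) * h 2

end Structure

/-! ### Holomorphic functions for an almost complex structure. -/

section Holomorphic

open Filter
open scoped Topology

variable {n : ℕ} {M : Type*} [TopologicalSpace M] [ChartedSpace (EuclideanSpace ℝ (Fin n)) M]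
  {J : EndField n M} {U : Set M} {u v : M → ℂ}

theorem IsHolomorphicOn.mdifferentiableAt (hu : IsHolomorphicOn J u U) (hU : IsOpen U) {x : M}
    (hx : x ∈ U) : MDifferentiableAt (𝓡 n) 𝓘(ℝ, ℂ) u x :=
  (hu.1.contMDiffAt (hU.mem_nhds hx)).mdifferentiableAt (by simp)

theorem IsHolomorphicOn.mul (hU : IsOpen U) (hu : IsHolomorphicOn J u U)
    (hv : IsHolomorphicOn J v U) : IsHolomorphicOn J (fun x => u x * v x) U := by
  refine ⟨fun x hx => (contMDiffAt_mul (hu.1.contMDiffAt (hU.mem_nhds hx))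
    (hv.1.contMDiffAt (hU.mem_nhds hx))).contMDiffWithinAt, fun x hx X => ?_⟩
  rw [cdiff_mul_apply (hu.mdifferentiableAt hU hx) (hv.mdifferentiableAt hU hx),
    cdiff_mul_apply (hu.mdifferentiableAt hU hx) (hv.mdifferentiableAt hU hx), hu.2 x hx,
    hv.2 x hx]
  ring

theorem IsHolomorphicOn.congr (hU : IsOpen U) (hu : IsHolomorphicOn J u U)
    (h : ∀ x ∈ U, v x = u x) : IsHolomorphicOn J v U := by
  refine ⟨hu.1.congr h, fun x hx X => ?_⟩
  have he : v =ᶠ[𝓝 x] u := by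
    filter_upwards [hU.mem_nhds hx] with y hy using h y hy
  rw [cdiff_congr he, hu.2 x hx]

theorem IsHolomorphicOn.mono {U' : Set M} (hu : IsHolomorphicOn J u U) (h : U' ⊆ U) :
    IsHolomorphicOn J u U' :=
  ⟨hu.1.mono h, fun x hx => hu.2 x (h hx)⟩

/-- If `u v` and `v` are holomorphic, then so is `u` wherever `v` does not vanish. -/
theorem type10_of_mul (hU : IsOpen U) {x : M} (hx : x ∈ U)
    (hu : MDifferentiableAt (𝓡 n) 𝓘(ℝ, ℂ) u x) (hv : IsHolomorphicOn J v U)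
    (huv : IsHolomorphicOn J (fun y => u y * v y) U) (h0 : v x ≠ 0) (X : TangentSpace (𝓡 n) x) :
    cdiff (n := n) u x (J x X) = Complex.I * cdiff (n := n) u x X := by
  have h := huv.2 x hx X
  rw [cdiff_mul_apply hu (hv.mdifferentiableAt hU hx),
    cdiff_mul_apply hu (hv.mdifferentiableAt hU hx), hv.2 x hx] at h
  refine mul_left_cancel₀ h0 ?_
  linear_combination h

end Holomorphic

/-! ### Holomorphic multiples of `Ω⁻¹` are holomorphic Poisson. -/

section Poisson

variable {M : Type*} [TopologicalSpace M] [ChartedSpace (EuclideanSpace ℝ (Fin 4)) M]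

theorem exists_tangentVector_ne_zero (x : M) : ∃ v : TangentSpace (𝓡 4) x, v ≠ 0 := by
  have : Nontrivial (TangentSpace (𝓡 4) x) :=
    Module.nontrivial_of_finrank_pos (R := ℝ) (by rw [finrank_tangentSpace]; norm_num)
  exact exists_ne 0

/-- A choice of nonzero tangent vectors. -/
noncomputable def tangentVector (x : M) : TangentSpace (𝓡 4) x :=
  Classical.choose (exists_tangentVector_ne_zero x)

theorem tangentVector_ne_zero (x : M) : tangentVector x ≠ 0 :=
  Classical.choose_spec (exists_tangentVector_ne_zero x)

variable [IsManifold (𝓡 4) ∞ M] (hk : HyperkahlerStructure 4 M) {b c : Fin 3 → ℝ} {U : Set M}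
  {u v : M → ℂ}

/-- The holomorphic Poisson bivector dual to the holomorphic symplectic form. -/
noncomputable def HyperkahlerStructure.holPoisson (b c : Fin 3 → ℝ) : CBivectorField 4 M :=
  fun x => symplecticInverse (hk.metric.inner x) (hk.complexStructure (b ⨯₃ c) x)
    (hk.complexStructure b x) (tangentVector x)

theorem HyperkahlerStructure.triple (hb : b ⬝ᵥ b = 1) (hc : c ⬝ᵥ c = 1) (hbc : b ⬝ᵥ c = 0)
    (x : M) : IsQuaternionTriple (hk.metric.inner x) (hk.complexStructure (b ⨯₃ c) x)
      (hk.complexStructure b x) (hk.complexStructure c x) :=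
  isQuaternionTriple_of_orthonormal (J := fun i => hk.J i x) (hk.isQuaternionTriple x) hb hc hbc

theorem HyperkahlerStructure.exists_holSymplectic_ne_zero (hb : b ⬝ᵥ b = 1) (hc : c ⬝ᵥ c = 1)
    (hbc : b ⬝ᵥ c = 0) (x : M) : ∃ X Y, hk.holSymplectic b c x X Y ≠ 0 :=
  ⟨_, _, exists_symplectic_ne_zero (hk.triple hb hc hbc x) (tangentVector_ne_zero x)
    (hk.holSymplectic_eq b c x)⟩

theorem HyperkahlerStructure.wedge_eq_holPoisson_mul (hb : b ⬝ᵥ b = 1) (hc : c ⬝ᵥ c = 1)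
    (hbc : b ⬝ᵥ c = 0) {x : M} {α β : CCovector (TangentSpace (𝓡 4) x)}
    (hα : ∀ X, α (hk.complexStructure (b ⨯₃ c) x X) = Complex.I * α X)
    (hβ : ∀ X, β (hk.complexStructure (b ⨯₃ c) x X) = Complex.I * β X)
    (X Y : TangentSpace (𝓡 4) x) :
    α X * β Y - α Y * β X = hk.holPoisson b c x α β * hk.holSymplectic b c x X Y :=
  wedge_eq_symplecticInverse_mul (hk.triple hb hc hbc x) (finrank_tangentSpace x)
    (tangentVector_ne_zero x) (hk.holSymplectic_eq b c x) hα hβ X Y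

/-- From `du ∧ dv = {u, v} Ω` and `dΩ = 0` follows `d{u, v} ∧ Ω = 0`, and a covector annihilated by
wedging with `Ω` has type (1,0). -/
theorem HyperkahlerStructure.isHolomorphicOn_bracket_holPoisson (hb : b ⬝ᵥ b = 1)
    (hc : c ⬝ᵥ c = 1) (hbc : b ⬝ᵥ c = 0) (hU : IsOpen U)
    (hu : IsHolomorphicOn (hk.complexStructure (b ⨯₃ c)) u U)
    (hv : IsHolomorphicOn (hk.complexStructure (b ⨯₃ c)) v U) :
    IsHolomorphicOn (hk.complexStructure (b ⨯₃ c)) (bracket (hk.holPoisson b c) u v) U := by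
  have hs : ∀ (x : M) (e : EuclideanSpace ℝ (Fin 4)), SmoothFieldAt (chartField x e) x :=
    fun x e => smoothFieldAt_chartField x e (mem_extChartAt_source x)
  have h := smooth_and_cdiff_wedge_eq_zero (F := bracket (hk.holPoisson b c) u v)
    (Ω := hk.holSymplectic b c) hU hu.1 hv.1
    (fun x e e' => hk.contMDiffAt_holSymplectic b c (hs x e) (hs x e'))
    (hk.holSymplectic_closed b c) (hk.exists_holSymplectic_ne_zero hb hc hbc)
    (fun y hy X Y => hk.wedge_eq_holPoisson_mul hb hc hbc (hu.2 y hy) (hv.2 y hy) X Y)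
  exact ⟨h.1, fun x hx X => type10_of_wedge_eq_zero (hk.triple hb hc hbc x)
    (tangentVector_ne_zero x) (hk.holSymplectic_eq b c x) (h.2 x hx) X⟩

/-- The multiples of `Ω⁻¹` by holomorphic functions are holomorphic Poisson. -/
theorem HyperkahlerStructure.isHolomorphicPoisson_of_eq_mul (hb : b ⬝ᵥ b = 1)
    (hc : c ⬝ᵥ c = 1) (hbc : b ⬝ᵥ c = 0) {σ : CBivectorField 4 M} {h : M → ℂ}
    (hh : IsHolomorphicOn (hk.complexStructure (b ⨯₃ c)) h Set.univ)
    (htype : ∀ x, IsType20 (hk.complexStructure (b ⨯₃ c) x) (σ x))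
    (hσ : ∀ x (α β : CCovector (TangentSpace (𝓡 4) x)),
      (∀ X, α (hk.complexStructure (b ⨯₃ c) x X) = Complex.I * α X) →
      (∀ X, β (hk.complexStructure (b ⨯₃ c) x X) = Complex.I * β X) →
      σ x α β = h x * hk.holPoisson b c x α β) :
    IsHolomorphicPoisson (hk.complexStructure (b ⨯₃ c)) σ := by
  have hbr : ∀ (U : Set M) (u v : M → ℂ), IsOpen U →
      IsHolomorphicOn (hk.complexStructure (b ⨯₃ c)) u U →
      IsHolomorphicOn (hk.complexStructure (b ⨯₃ c)) v U →
      IsHolomorphicOn (hk.complexStructure (b ⨯₃ c)) (bracket σ u v) U := by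
    intro U u v hU hu hv
    refine IsHolomorphicOn.congr hU (IsHolomorphicOn.mul hU (hh.mono (Set.subset_univ U))
      (hk.isHolomorphicOn_bracket_holPoisson hb hc hbc hU hu hv)) fun x hx => ?_
    exact hσ x _ _ (hu.2 x hx) (hv.2 x hx)
  refine ⟨⟨htype, hbr⟩, fun U u v w hU hu hv hw x hx => ?_⟩
  have h0 := hbr U v w hU hv hw
  have h1 := hbr U w u hU hw hu
  have h2 := hbr U u v hU hu hv
  obtain ⟨X, Y, hne⟩ := hk.exists_holSymplectic_ne_zero hb hc hbc x
  -- The Cramer relation reads `{v,w} du + {w,u} dv + {u,v} dw = 0` for the bracket of `σ`; its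
  -- exterior derivative is `∑ d{v,w} ∧ du = 0`.
  have hsum := sum_cdiff_wedge_eq_zero (s := ![bracket σ v w, bracket σ w u, bracket σ u v])
    (u := ![u, v, w]) hU
    (by intro i; fin_cases i; exacts [h0.1, h1.1, h2.1])
    (by intro i; fin_cases i; exacts [hu.1, hv.1, hw.1])
    (fun y hy Z => by
      have e1 := hσ y _ _ (hv.2 y hy) (hw.2 y hy)
      have e2 := hσ y _ _ (hw.2 y hy) (hu.2 y hy)
      have e3 := hσ y _ _ (hu.2 y hy) (hv.2 y hy)
      have hcyc := symplecticInverse_cyclic (hk.triple hb hc hbc y) (finrank_tangentSpace y)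
        (tangentVector_ne_zero y) (hu.2 y hy) (hv.2 y hy) (hw.2 y hy) Z
      simp only [Fin.sum_univ_three, Matrix.cons_val, bracket, e1, e2, e3,
        HyperkahlerStructure.holPoisson]
      linear_combination h y * hcyc) hx X Y
  simp only [Fin.sum_univ_three, Matrix.cons_val] at hsum
  have w0 := hk.wedge_eq_holPoisson_mul hb hc hbc (hu.2 x hx) (h0.2 x hx) X Y
  have w1 := hk.wedge_eq_holPoisson_mul hb hc hbc (hv.2 x hx) (h1.2 x hx) X Y
  have w2 := hk.wedge_eq_holPoisson_mul hb hc hbc (hw.2 x hx) (h2.2 x hx) X Y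
  have e0 := hσ x _ _ (hu.2 x hx) (h0.2 x hx)
  have e1 := hσ x _ _ (hv.2 x hx) (h1.2 x hx)
  have e2 := hσ x _ _ (hw.2 x hx) (h2.2 x hx)
  -- Each `du ∧ d{v,w}` is `Ω⁻¹(du, d{v,w}) Ω`, so the Jacobiator times `Ω(X, Y)` is `h` times a
  -- vanishing sum.
  refine mul_right_cancel₀ hne ?_
  rw [schoutenSelf, bracket, e0]
  nth_rewrite 1 [bracket]
  rw [e1]
  nth_rewrite 1 [bracket]
  rw [e2]
  linear_combination -h x * (w0 + w1 + w2) - h x * hsum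

end Poisson

/-! ### Smoothness of a bivector field on smooth covector fields. -/

section Coefficients

open Filter
open scoped Topology

variable {n : ℕ} {M : Type*} [TopologicalSpace M] [ChartedSpace (EuclideanSpace ℝ (Fin n)) M]
  [IsManifold (𝓡 n) ∞ M]

/-- The coordinate functions of the preferred chart at `x₀`. -/
noncomputable def chartCoord (x₀ : M) (i : Fin n) (y : M) : ℝ := extChartAt (𝓡 n) x₀ y i

theorem contMDiffOn_chartCoord (x₀ : M) (i : Fin n) :
    ContMDiffOn (𝓡 n) 𝓘(ℝ, ℝ) ∞ (chartCoord x₀ i) (extChartAt (𝓡 n) x₀).source := by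
  have h := contMDiffOn_extChartAt (I := 𝓡 n) (n := ∞) (x := x₀)
  rw [← extChartAt_source (𝓡 n)] at h
  exact (EuclideanSpace.proj i :
    EuclideanSpace ℝ (Fin n) →L[ℝ] ℝ).contDiff.contMDiff.comp_contMDiffOn h

theorem covector_eq_sum_rdiff_chartCoord {x₀ y : M} (hy : y ∈ (extChartAt (𝓡 n) x₀).source)
    (α : TangentSpace (𝓡 n) y →L[ℝ] ℝ) :
    α = ∑ i, α (chartField x₀ (EuclideanSpace.single i 1) y) •
      rdiff (n := n) (chartCoord x₀ i) y := by
  have hfield : ∀ X : TangentSpace (𝓡 n) y, ∃ e : EuclideanSpace ℝ (Fin n),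
      chartField x₀ e y = X ∧ ∀ i, rdiff (n := n) (chartCoord x₀ i) y X = e i := by
    intro X
    refine ⟨mfderiv (𝓡 n) 𝓘(ℝ, EuclideanSpace ℝ (Fin n)) (extChartAt (𝓡 n) x₀) y X, ?_, ?_⟩
    · refine (mfderivWithin_symm_eq_chartField hy _).trans ?_
      exact congrArg (fun A : TangentSpace (𝓡 n) y →L[ℝ] TangentSpace (𝓡 n) y => A X)
        (mfderivWithin_extChartAt_symm_comp_mfderiv_extChartAt' hy)
    · intro i
      have hφ : MDifferentiableAt (𝓡 n) 𝓘(ℝ, EuclideanSpace ℝ (Fin n)) (extChartAt (𝓡 n) x₀) y :=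
        mdifferentiableAt_extChartAt (by rwa [extChartAt_source] at hy)
      have h := ((EuclideanSpace.proj i : EuclideanSpace ℝ (Fin n) →L[ℝ]
        ℝ).hasFDerivAt.hasMFDerivAt.comp y hφ.hasMFDerivAt).mfderiv
      exact congrArg (fun A : TangentSpace (𝓡 n) y →L[ℝ] ℝ => A X) h
  ext X
  obtain ⟨e, rfl, he⟩ := hfield X
  simp only [sum_apply, smul_apply, he, smul_eq_mul]
  have hexp : e = ∑ i, e i • EuclideanSpace.single i (1 : ℝ) := by
    ext j; simp [Finset.sum_apply, Pi.single_apply]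
  conv_lhs => rw [hexp]
  simp only [chartField, map_sum, map_smul, smul_eq_mul, mul_comm]

variable (hk : HyperkahlerStructure n M) (P : BivectorField n M)
  {X Y : ∀ x : M, TangentSpace (𝓡 n) x} {x : M}

/-- Smoothness of `P` is given only on differentials of functions, so the covectors `g(X, ·)` and
`g(Y, ·)` are expanded in coordinate differentials. -/
theorem contMDiffAt_bivector_inner (hX : SmoothFieldAt X x) (hY : SmoothFieldAt Y x) :
    ContMDiffAt (𝓡 n) 𝓘(ℝ, ℝ) ∞
      (fun y => P.toFun y (hk.metric.inner y (X y)) (hk.metric.inner y (Y y))) x := by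
  have hs : ∀ e : EuclideanSpace ℝ (Fin n), SmoothFieldAt (chartField x e) x := fun e =>
    smoothFieldAt_chartField x e (mem_extChartAt_source x)
  have hsm : ContMDiffAt (𝓡 n) 𝓘(ℝ, ℝ) ∞ (fun y => ∑ i, ∑ j,
      hk.metric.inner y (X y) (chartField x (EuclideanSpace.single i 1) y) *
      (hk.metric.inner y (Y y) (chartField x (EuclideanSpace.single j 1) y) *
      P.toFun y (rdiff (chartCoord x i) y) (rdiff (chartCoord x j) y))) x := by
    refine contMDiffAt_finsetSum fun i _ => contMDiffAt_finsetSum fun j _ => ?_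
    refine (hk.contMDiffAt_inner hX (hs _)).mul ((hk.contMDiffAt_inner hY (hs _)).mul ?_)
    exact (P.smooth _ _ _ (isOpen_extChartAt_source x) (contMDiffOn_chartCoord x i)
      (contMDiffOn_chartCoord x j)).contMDiffAt (extChartAt_source_mem_nhds x)
  refine hsm.congr_of_eventuallyEq ?_
  filter_upwards [extChartAt_source_mem_nhds (I := 𝓡 n) x] with y hy
  conv_lhs =>
    rw [covector_eq_sum_rdiff_chartCoord hy (hk.metric.inner y (X y)),
      covector_eq_sum_rdiff_chartCoord hy (hk.metric.inner y (Y y))]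
  simp only [map_sum, map_smul, LinearMap.sum_apply, LinearMap.smul_apply, smul_eq_mul,
    Finset.mul_sum]
  rw [Finset.sum_comm]
  exact Finset.sum_congr rfl fun i _ => Finset.sum_congr rfl fun j _ => by ring

end Coefficients

/-! ### The function `F = ∑ f_a (b_a + i c_a)`. -/

section Combination

variable {M : Type*} [TopologicalSpace M] [ChartedSpace (EuclideanSpace ℝ (Fin 4)) M]
  {f : Fin 3 → M → ℝ}

/-- The function `∑ fₐ (bₐ + i cₐ)`. -/
noncomputable def complexCombination (f : Fin 3 → M → ℝ) (b c : Fin 3 → ℝ) (x : M) : ℂ :=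
  ∑ a, (f a x : ℂ) * (b a + c a * Complex.I)

theorem contMDiff_complexCombination (hf : ∀ a, ContMDiff (𝓡 4) 𝓘(ℝ, ℝ) ∞ (f a))
    (b c : Fin 3 → ℝ) : ContMDiff (𝓡 4) 𝓘(ℝ, ℂ) ∞ (complexCombination f b c) := by
  intro x
  have h : ∀ a, ContMDiffAt (𝓡 4) 𝓘(ℝ, ℂ) ∞
      (fun y => (f a y : ℂ) * ((b a : ℂ) + c a * Complex.I)) x := fun a =>
    contMDiffAt_mul (contMDiffAt_ofReal (hf a x)) contMDiffAt_const
  exact contMDiffAt_finsetSum fun a _ => h a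

theorem cdiff_complexCombination (hf : ∀ a, ContMDiff (𝓡 4) 𝓘(ℝ, ℝ) ∞ (f a))
    (b c : Fin 3 → ℝ) (x : M) (X : TangentSpace (𝓡 4) x) :
    cdiff (n := 4) (complexCombination f b c) x X =
      ∑ a, (rdiff (n := 4) (f a) x X : ℂ) * (b a + c a * Complex.I) := by
  have h : ∀ a, MDifferentiableAt (𝓡 4) 𝓘(ℝ, ℝ) (f a) x := fun a =>
    (hf a x).mdifferentiableAt (by simp)
  have h' : ∀ a, MDifferentiableAt (𝓡 4) 𝓘(ℝ, ℂ)
      (fun y => ((b a : ℂ) + c a * Complex.I) * (f a y : ℂ)) x := fun a =>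
    mdifferentiableAt_const.mul (mdifferentiableAt_ofReal (h a))
  have he : complexCombination f b c = fun y => ((b 0 : ℂ) + c 0 * Complex.I) * (f 0 y : ℂ) +
      ((b 1 : ℂ) + c 1 * Complex.I) * (f 1 y : ℂ) +
      ((b 2 : ℂ) + c 2 * Complex.I) * (f 2 y : ℂ) := by
    ext y; simp only [complexCombination, Fin.sum_univ_three]; ring
  rw [he, cdiff_add_apply (f := fun y => ((b 0 : ℂ) + c 0 * Complex.I) * (f 0 y : ℂ) +
      ((b 1 : ℂ) + c 1 * Complex.I) * (f 1 y : ℂ)) ((h' 0).add (h' 1)) (h' 2),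
    cdiff_add_apply (h' 0) (h' 1), Fin.sum_univ_three]
  simp only [cdiff_const_mul_apply _ (mdifferentiableAt_ofReal (h _)), cdiff_ofReal_apply (h _)]
  ring

end Combination

/-! ### Both directions of the equivalence, and compatibility. -/

section Main

open Filter
open scoped Topology

variable {M : Type*} [TopologicalSpace M] [ChartedSpace (EuclideanSpace ℝ (Fin 4)) M]
  [IsManifold (𝓡 4) ∞ M] (hk : HyperkahlerStructure 4 M) {P : BivectorField 4 M}
  {f : Fin 3 → M → ℝ} {b c : Fin 3 → ℝ}

/-- A coordinate field that is nonzero at `x` stays nonzero nearby and can serve as `v` in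
`coefficient_eq`; the resulting quotient is smooth. -/
theorem HyperkahlerStructure.contMDiff_coefficient
    (hP : ∀ x α β, P.toFun x α β = ∑ a, f a x * inverseBivector (hk.kahlerForm a x) α β)
    (a : Fin 3) : ContMDiff (𝓡 4) 𝓘(ℝ, ℝ) ∞ (f a) := by
  intro x
  obtain ⟨X, hX⟩ := exists_tangentVector_ne_zero x
  obtain ⟨e, rfl⟩ := exists_chartField_eq x X
  have hs := smoothFieldAt_chartField x e (mem_extChartAt_source x)
  have hne := (hk.metric.pos x _ hX).ne'
  have hin := hk.contMDiffAt_inner hs hs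
  refine ((contMDiffAt_bivector_inner hk P hs (hk.smoothFieldAt_J a hs)).div₀ hin
    hne).congr_of_eventuallyEq ?_
  filter_upwards [hin.continuousAt.eventually_ne hne] with y hy
  refine coefficient_eq (f := fun a => f a y) (J := fun i => hk.J i y) (hk.isQuaternionTriple y)
    (finrank_tangentSpace y) (hP y) ?_ a
  rintro h0
  rw [h0] at hy
  simp at hy

/-- With `θ` the common covector, `df_a = -θ ∘ J_a`, hence `dF = -(θ ∘ I_b + i θ ∘ I_c)`. Type (1,0)
follows from `I_b I_ζ = -I_c` and `I_c I_ζ = I_b`. -/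
theorem HyperkahlerStructure.isHolomorphicOn_complexCombination
    (hf : ∀ a, ContMDiff (𝓡 4) 𝓘(ℝ, ℝ) ∞ (f a))
    (hdf : ∀ x, (rdiff (f 0) x).comp (hk.J 0 x) = (rdiff (f 1) x).comp (hk.J 1 x) ∧
      (rdiff (f 1) x).comp (hk.J 1 x) = (rdiff (f 2) x).comp (hk.J 2 x))
    (hb : b ⬝ᵥ b = 1) (hc : c ⬝ᵥ c = 1) (hbc : b ⬝ᵥ c = 0) :
    IsHolomorphicOn (hk.complexStructure (b ⨯₃ c)) (complexCombination f b c) Set.univ := by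
  refine ⟨(contMDiff_complexCombination hf b c).contMDiffOn, fun x _ X => ?_⟩
  set θ := (rdiff (n := 4) (f 0) x).comp (hk.J 0 x) with hθ
  have key : ∀ Y, cdiff (n := 4) (complexCombination f b c) x Y =
      -(θ (hk.complexStructure b x Y) + θ (hk.complexStructure c x Y) * Complex.I) := by
    intro Y
    have hd : ∀ a, rdiff (n := 4) (f a) x Y = -θ (hk.J a x Y) := by
      intro a
      have : θ (hk.J a x Y) = (rdiff (n := 4) (f a) x).comp (hk.J a x) (hk.J a x Y) := by
        fin_cases a
        · rfl
        · exact congrArg (fun A => A (hk.J 1 x Y)) (hdf x).1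
        · exact congrArg (fun A => A (hk.J 2 x Y)) ((hdf x).1.trans (hdf x).2)
      rw [this, ContinuousLinearMap.comp_apply, hk.sq, map_neg, neg_neg]
    rw [cdiff_complexCombination hf]
    simp only [hd, Fin.sum_univ_three, HypercomplexStructure.complexStructure, add_apply,
      smul_apply, map_add, map_smul, smul_eq_mul]
    push_cast
    ring
  have hT := hk.triple hb hc hbc x
  rw [key, key, hT.mulJI, hT.mulKI, map_neg]
  push_cast
  linear_combination (θ (hk.complexStructure c x X) : ℂ) * Complex.I_mul_I

theorem HyperkahlerStructure.component20_eq_mul_holPoisson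
    (hP : ∀ x α β, P.toFun x α β = ∑ a, f a x * inverseBivector (hk.kahlerForm a x) α β)
    (hb : b ⬝ᵥ b = 1) (hc : c ⬝ᵥ c = 1) (hbc : b ⬝ᵥ c = 0) (x : M)
    (α β : CCovector (TangentSpace (𝓡 4) x))
    (hα : ∀ X, α (hk.complexStructure (b ⨯₃ c) x X) = Complex.I * α X)
    (hβ : ∀ X, β (hk.complexStructure (b ⨯₃ c) x X) = Complex.I * β X) :
    P.component20 (hk.complexStructure (b ⨯₃ c)) x α β =
      2 * complexCombination f b c x * hk.holPoisson b c x α β := by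
  rw [BivectorField.component20, component20_apply, proj10_of_type10 hα, proj10_of_type10 hβ]
  exact complexify_eq_mul_symplecticInverse (J := fun i => hk.J i x) (f := fun a => f a x)
    (hk.isQuaternionTriple x) (finrank_tangentSpace x) (hP x) (tangentVector_ne_zero x) hb hc hbc
    hα hβ

theorem HyperkahlerStructure.isType20_component20 (P : BivectorField 4 M) (hb : b ⬝ᵥ b = 1)
    (hc : c ⬝ᵥ c = 1) (hbc : b ⬝ᵥ c = 0) (x : M) :
    IsType20 (hk.complexStructure (b ⨯₃ c) x)
      (P.component20 (hk.complexStructure (b ⨯₃ c)) x) :=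
  HyperPoisson.isType20_component20 (hk.triple hb hc hbc x).sqI
    (complexify_self (P.alternating x))

theorem exists_orthonormal_crossProduct_eq {a : Fin 3 → ℝ} (ha : a ⬝ᵥ a = 1) :
    ∃ b c : Fin 3 → ℝ, b ⬝ᵥ b = 1 ∧ c ⬝ᵥ c = 1 ∧ b ⬝ᵥ c = 0 ∧ b ⨯₃ c = a := by
  obtain ⟨b, hb, hab⟩ : ∃ b : Fin 3 → ℝ, b ⬝ᵥ b = 1 ∧ a ⬝ᵥ b = 0 := by
    -- A unit vector orthogonal to `a` is obtained by turning its horizontal part through a right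
    -- angle; if that part vanishes, the first axis serves.
    by_cases h : a 0 ^ 2 + a 1 ^ 2 = 0
    · refine ⟨![1, 0, 0], by simp [dotProduct, Fin.sum_univ_three], ?_⟩
      have : a 0 = 0 := by nlinarith [sq_nonneg (a 0), sq_nonneg (a 1)]
      simp [dotProduct, Fin.sum_univ_three, this]
    · have hp : 0 < a 0 ^ 2 + a 1 ^ 2 := lt_of_le_of_ne (by positivity) (Ne.symm h)
      have hq := Real.sq_sqrt hp.le
      have hq0 := (Real.sqrt_pos.2 hp).ne'
      set t := Real.sqrt (a 0 ^ 2 + a 1 ^ 2)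
      refine ⟨![-(a 1) / t, a 0 / t, 0], ?_, ?_⟩
      · simp only [dotProduct, Fin.sum_univ_three, Matrix.cons_val]
        field_simp
        linarith
      · simp only [dotProduct, Fin.sum_univ_three, Matrix.cons_val]
        field_simp
        ring
  obtain ⟨h1, -, -, h2⟩ := crossProduct_orthonormal ha hb hab
  refine ⟨b, a ⨯₃ b, hb, h1, dot_cross_self _ _, ?_⟩
  rw [← cross_anticomm, h2, neg_neg]

theorem HyperkahlerStructure.isHyperPoisson_of_eq_sum
    (hf : ∀ a, ContMDiff (𝓡 4) 𝓘(ℝ, ℝ) ∞ (f a))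
    (hdf : ∀ x, (rdiff (f 0) x).comp (hk.J 0 x) = (rdiff (f 1) x).comp (hk.J 1 x) ∧
      (rdiff (f 1) x).comp (hk.J 1 x) = (rdiff (f 2) x).comp (hk.J 2 x))
    (hP : ∀ x α β, P.toFun x α β = ∑ a, f a x * inverseBivector (hk.kahlerForm a x) α β) :
    IsHyperPoisson hk.toHypercomplexStructure P := by
  refine ⟨fun x => complexify_mem_lambda2E_S2H (J := fun i => hk.J i x) (f := fun a => f a x)
    (hk.isQuaternionTriple x) (finrank_tangentSpace x) (hP x), fun a ha => ?_⟩
  obtain ⟨b, c, hb, hc, hbc, rfl⟩ := exists_orthonormal_crossProduct_eq ha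
  have hconst : IsHolomorphicOn (hk.complexStructure (b ⨯₃ c)) (fun _ => (2 : ℂ)) Set.univ :=
    ⟨contMDiffOn_const, fun x _ X => by rw [cdiff_const_apply, cdiff_const_apply, mul_zero]⟩
  exact hk.isHolomorphicPoisson_of_eq_mul hb hc hbc
    (hconst.mul isOpen_univ (hk.isHolomorphicOn_complexCombination hf hdf hb hc hbc))
    (hk.isType20_component20 P hb hc hbc)
    (hk.component20_eq_mul_holPoisson hP hb hc hbc)

theorem HyperkahlerStructure.isCompatibleWith_of_eq_sum
    (hf : ∀ a, ContMDiff (𝓡 4) 𝓘(ℝ, ℝ) ∞ (f a))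
    (hdf : ∀ x, (rdiff (f 0) x).comp (hk.J 0 x) = (rdiff (f 1) x).comp (hk.J 1 x) ∧
      (rdiff (f 1) x).comp (hk.J 1 x) = (rdiff (f 2) x).comp (hk.J 2 x))
    (hP : ∀ x α β, P.toFun x α β = ∑ a, f a x * inverseBivector (hk.kahlerForm a x) α β) :
    IsCompatibleWith hk P := by
  intro b c hb hc hbc
  refine ⟨hk.holPoisson b c, fun x => isInverse20_symplecticInverse (hk.triple hb hc hbc x)
    (finrank_tangentSpace x) (tangentVector_ne_zero x) (hk.holSymplectic_eq b c x),
    fun s t => ?_⟩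
  have hh := hk.isHolomorphicOn_complexCombination hf hdf hb hc hbc
  have hd : ∀ x, MDifferentiableAt (𝓡 4) 𝓘(ℝ, ℂ)
      (fun y => 2 * s * complexCombination f b c y) x := fun x =>
    mdifferentiableAt_const.mul (hh.mdifferentiableAt isOpen_univ (Set.mem_univ x))
  -- On type (1,0) the linear combination is `(2 s F + t) Ω⁻¹`.
  refine hk.isHolomorphicPoisson_of_eq_mul hb hc hbc
    (h := fun x => 2 * s * complexCombination f b c x + t) ⟨?_, fun x _ X => ?_⟩ (fun x => ?_)
    fun x α β hα hβ => ?_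
  · intro x _
    have h1 := contMDiff_complexCombination hf b c x
    have h2 : ContMDiffAt (𝓡 4) 𝓘(ℝ, ℂ) ∞ (fun _ : M => 2 * s) x := contMDiffAt_const
    exact ((contMDiffAt_mul h2 h1).add contMDiffAt_const).contMDiffWithinAt
  · rw [cdiff_add_apply (hd x) mdifferentiableAt_const, cdiff_const_apply,
      cdiff_const_mul_apply _ (hh.mdifferentiableAt isOpen_univ (Set.mem_univ x)),
      cdiff_add_apply (hd x) mdifferentiableAt_const, cdiff_const_apply,
      cdiff_const_mul_apply _ (hh.mdifferentiableAt isOpen_univ (Set.mem_univ x)),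
      hh.2 x (Set.mem_univ x)]
    ring
  · have h1 := hk.isType20_component20 P hb hc hbc x
    have h2 : IsType20 (hk.complexStructure (b ⨯₃ c) x) (hk.holPoisson b c x) :=
      isType20_symplecticInverse (hk.triple hb hc hbc x) _
    refine ⟨fun α => ?_, fun α β => ?_⟩
    · simp only [LinearMap.add_apply, LinearMap.smul_apply, h1.1, h2.1, smul_zero, add_zero]
    · simp only [LinearMap.add_apply, LinearMap.smul_apply, h1.2, h2.2, smul_eq_mul]
      ring
  · simp only [LinearMap.add_apply, LinearMap.smul_apply, smul_eq_mul]
    rw [hk.component20_eq_mul_holPoisson hP hb hc hbc x α β hα hβ]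
    ring

/-- Holomorphic coordinates contain two functions with nonzero bracket. -/
theorem HyperkahlerStructure.exists_bracket_ne_zero (hb : b ⬝ᵥ b = 1) (hc : c ⬝ᵥ c = 1)
    (hbc : b ⬝ᵥ c = 0) (hint : IsIntegrable (hk.complexStructure (b ⨯₃ c))) (x : M) :
    ∃ U : Set M, IsOpen U ∧ x ∈ U ∧ ∃ u v : M → ℂ,
      IsHolomorphicOn (hk.complexStructure (b ⨯₃ c)) u U ∧
      IsHolomorphicOn (hk.complexStructure (b ⨯₃ c)) v U ∧
      bracket (hk.holPoisson b c) u v x ≠ 0 := by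
  obtain ⟨U, hU, hx, m, z, hz, -, hbij⟩ := hint x
  have hinj : ∀ X : TangentSpace (𝓡 4) x, X ≠ 0 → ∃ k, cdiff (n := 4) (z k) x X ≠ 0 := by
    intro X hX
    by_contra! h
    refine hX ((hbij x hx).injective ?_)
    funext k
    rw [h k, map_zero]
  obtain ⟨X, hX⟩ := exists_tangentVector_ne_zero x
  obtain ⟨k, hk0⟩ := hinj X hX
  -- The real rank of `dz_k` is at most 2, below 4, so there is `Y ≠ 0` with `dz_k Y = 0`. Some
  -- `dz_l Y ≠ 0`, and then `(dz_k ∧ dz_l)(X, Y) = dz_k X · dz_l Y ≠ 0`.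
  have hker : LinearMap.ker (cdiff (n := 4) (z k) x : TangentSpace (𝓡 4) x →ₗ[ℝ] ℂ) ≠ ⊥ := by
    intro h0
    have := LinearMap.finrank_le_finrank_of_injective (LinearMap.ker_eq_bot.mp h0)
    rw [finrank_tangentSpace, Complex.finrank_real_complex] at this
    omega
  obtain ⟨Y, hY, hY0⟩ := Submodule.exists_mem_ne_zero_of_ne_bot hker
  obtain ⟨l, hl⟩ := hinj Y hY0
  refine ⟨U, hU, hx, z k, z l, hz k, hz l, fun h0 => ?_⟩
  have hw := hk.wedge_eq_holPoisson_mul hb hc hbc ((hz k).2 x hx) ((hz l).2 x hx) X Y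
  have hY' : cdiff (n := 4) (z k) x Y = 0 := hY
  rw [bracket] at h0
  rw [h0, hY', zero_mul, zero_mul, sub_zero] at hw
  exact mul_ne_zero hk0 hl hw

/-- The bracket of two holomorphic functions under the (2,0)-component of `P` is `2 F {u, v}`. Both
it and `{u, v}` are holomorphic, and integrability provides `u, v` with `{u, v} ≠ 0` at `x`, so one
may divide. -/
theorem HyperkahlerStructure.type10_complexCombination
    (hf : ∀ a, ContMDiff (𝓡 4) 𝓘(ℝ, ℝ) ∞ (f a))
    (hP : ∀ x α β, P.toFun x α β = ∑ a, f a x * inverseBivector (hk.kahlerForm a x) α β)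
    (hb : b ⬝ᵥ b = 1) (hc : c ⬝ᵥ c = 1) (hbc : b ⬝ᵥ c = 0)
    (hint : IsIntegrable (hk.complexStructure (b ⨯₃ c)))
    (hhol : IsHolomorphicBivector (hk.complexStructure (b ⨯₃ c))
      (P.component20 (hk.complexStructure (b ⨯₃ c)))) (x : M) (X : TangentSpace (𝓡 4) x) :
    cdiff (n := 4) (complexCombination f b c) x (hk.complexStructure (b ⨯₃ c) x X) =
      Complex.I * cdiff (n := 4) (complexCombination f b c) x X := by
  obtain ⟨U, hU, hx, u, v, hu, hv, hne⟩ := hk.exists_bracket_ne_zero hb hc hbc hint x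
  have hd : MDifferentiableAt (𝓡 4) 𝓘(ℝ, ℂ) (complexCombination f b c) x :=
    (contMDiff_complexCombination hf b c x).mdifferentiableAt (by simp)
  have h2 := type10_of_mul (u := fun y => 2 * complexCombination f b c y) hU hx
    (mdifferentiableAt_const.mul hd) (hk.isHolomorphicOn_bracket_holPoisson hb hc hbc hU hu hv)
    (IsHolomorphicOn.congr hU (hhol.2 U u v hU hu hv) fun y hy =>
      (hk.component20_eq_mul_holPoisson hP hb hc hbc y _ _ (hu.2 y hy) (hv.2 y hy)).symm) hne X
  rw [cdiff_const_mul_apply _ hd, cdiff_const_mul_apply _ hd] at h2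
  linear_combination h2 / 2

theorem HyperkahlerStructure.exists_eq_sum_of_isHyperPoisson
    (h : IsHyperPoisson hk.toHypercomplexStructure P) :
    ∃ f : Fin 3 → M → ℝ, (∀ a, ContMDiff (𝓡 4) 𝓘(ℝ, ℝ) ∞ (f a)) ∧
      (∀ x, (rdiff (f 0) x).comp (hk.J 0 x) = (rdiff (f 1) x).comp (hk.J 1 x) ∧
        (rdiff (f 1) x).comp (hk.J 1 x) = (rdiff (f 2) x).comp (hk.J 2 x)) ∧
      ∀ x α β, P.toFun x α β = ∑ a, f a x * inverseBivector (hk.kahlerForm a x) α β := by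
  obtain ⟨hmem, hpois⟩ := h
  let f : Fin 3 → M → ℝ := fun a x => P.toFun x (hk.metric.inner x (tangentVector x))
    (hk.metric.inner x (hk.J a x (tangentVector x))) /
      hk.metric.inner x (tangentVector x) (tangentVector x)
  have hP : ∀ x α β, P.toFun x α β = ∑ a, f a x * inverseBivector (hk.kahlerForm a x) α β :=
    fun x => eq_sum_inverseBivector_of_mem (J := fun i => hk.J i x) (hk.isQuaternionTriple x)
      (finrank_tangentSpace x) (P.alternating x) (hmem x) (tangentVector_ne_zero x)
  have hf := hk.contMDiff_coefficient hP
  refine ⟨f, hf, fun x => ?_, hP⟩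
  -- Two points of the sphere suffice: for `J 0`, `F = f 1 + i f 2`; for `J 1`, `F = f 2 + i f 0`.
  have hc0 : hk.complexStructure (![0, 1, 0] ⨯₃ ![0, 0, 1]) = hk.J 0 := by
    funext y; simp [HypercomplexStructure.complexStructure, cross_apply, Fin.sum_univ_three]
  have hc1 : hk.complexStructure (![0, 0, 1] ⨯₃ ![1, 0, 0]) = hk.J 1 := by
    funext y; simp [HypercomplexStructure.complexStructure, cross_apply, Fin.sum_univ_three]
  have t0 := hk.type10_complexCombination (b := ![0, 1, 0]) (c := ![0, 0, 1]) hf hP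
    (by simp) (by simp) (by simp) (by rw [hc0]; exact hk.integrable 0)
    (hpois _ (by simp [cross_apply])).1 x
  have t1 := hk.type10_complexCombination (b := ![0, 0, 1]) (c := ![1, 0, 0]) hf hP
    (by simp) (by simp) (by simp) (by rw [hc1]; exact hk.integrable 1)
    (hpois _ (by simp [cross_apply])).1 x
  rw [hc0] at t0
  rw [hc1] at t1
  have hT := hk.isQuaternionTriple x
  -- Real parts of the two Cauchy–Riemann equations; composing them with quaternion products below
  -- gives the equalities of the `df_a ∘ J_a`.
  have r0 : ∀ X, rdiff (n := 4) (f 1) x (hk.J 0 x X) = -rdiff (n := 4) (f 2) x X := by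
    intro X
    have := congrArg Complex.re (t0 X)
    simpa [cdiff_complexCombination hf, Fin.sum_univ_three] using this
  have r1 : ∀ X, rdiff (n := 4) (f 2) x (hk.J 1 x X) = -rdiff (n := 4) (f 0) x X := by
    intro X
    have := congrArg Complex.re (t1 X)
    simpa [cdiff_complexCombination hf, Fin.sum_univ_three] using this
  have q0 : ∀ X, rdiff (n := 4) (f 2) x (hk.J 2 x X) = rdiff (n := 4) (f 1) x (hk.J 1 x X) := by
    intro X
    rw [← neg_neg (rdiff (f 2) x (hk.J 2 x X)), ← r0, hT.mulIK, map_neg, neg_neg]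
  have q1 : ∀ X, rdiff (n := 4) (f 0) x (hk.J 0 x X) = rdiff (n := 4) (f 2) x (hk.J 2 x X) := by
    intro X
    rw [← neg_neg (rdiff (f 0) x (hk.J 0 x X)), ← r1, hT.mulJI, map_neg, neg_neg]
  exact ⟨ContinuousLinearMap.ext fun X => (q1 X).trans (q0 X),
    ContinuousLinearMap.ext fun X => (q0 X).symm⟩

end Main

end HyperPoisson

open HyperPoisson
theorem mainTheorem5 {M : Type*} [TopologicalSpace M]
    [ChartedSpace (EuclideanSpace ℝ (Fin 4)) M] [IsManifold (𝓡 4) ∞ M]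
    (hk : HyperkahlerStructure 4 M) (P : BivectorField 4 M) :
    (IsHyperPoisson hk.toHypercomplexStructure P ↔
      ∃ f : Fin 3 → M → ℝ,
        (∀ a, ContMDiff (𝓡 4) 𝓘(ℝ, ℝ) ∞ (f a)) ∧
        (∀ x, (rdiff (f 0) x).comp (hk.J 0 x) = (rdiff (f 1) x).comp (hk.J 1 x) ∧
          (rdiff (f 1) x).comp (hk.J 1 x) = (rdiff (f 2) x).comp (hk.J 2 x)) ∧
        ∀ x α β, P.toFun x α β = ∑ a, f a x * inverseBivector (hk.kahlerForm a x) α β) ∧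
    (IsHyperPoisson hk.toHypercomplexStructure P → IsCompatibleWith hk P) := by
  refine ⟨⟨hk.exists_eq_sum_of_isHyperPoisson, ?_⟩, fun h => ?_⟩
  · rintro ⟨f, hf, hdf, hP⟩
    exact hk.isHyperPoisson_of_eq_sum hf hdf hP
  · obtain ⟨f, hf, hdf, hP⟩ := hk.exists_eq_sum_of_isHyperPoisson h
    exact hk.isCompatibleWith_of_eq_sum hf hdf hP
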